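/- Let $n\ge 2$, let $z_1,\dots,z_l\in\mathbb R^n$ be fixed source points and let $\alpha\in\mathbb R^l$ satisfy $\sum_{i=1}^l\alpha_i=1$. Put $Z=[z_1\ \dots\ z_l]\in\mathbb R^{n\times l}$, $\xi=(1,\dots,1)^\top\in\mathbb R^l$ and $D(\alpha)=\xi\alpha^\top-I_l$. A body with position $x(t)\in\mathbb R^n$ moves according to $\dot x=u+a$ for $t\ge 0$, where $u$ is the measured velocity and $a\in\mathbb R^n$ is an unknown constant bias. The measurements are $y_i=\tfrac12|x-z_i|^2$ ($1\le i\le l$). Define $$y_0=\sum_{i=1}^l\alpha_i\left(y_i-\tfrac12|z_i|^2\right),\qquad y=\left[y_0,\ y_1-y_0-\tfrac12|z_1|^2,\ \dots,\ y_l-y_0-\tfrac12|z_l|^2\right]^\top,$$ $$X=\left[x^\top,a^\top,y_0,a^\top x,|a|^2\right]^\top\in\mathbb R^{2n+3},\qquad \bar u=\Big[u^\top,0_{1\times n},-u^\top\sum_{i=1}^l\alpha_iz_i,0,0\Big]^\top,$$ $$A(t)=\begin{bmatrix}0&I_n&0&0&0\\0&0&0&0&0\\u^\top(t)&-\sum_i\alpha_iz_i^\top&0&1&0\\0&u^\top(t)&0&0&1\\0&0&0&0&0\end{bmatrix},\qquad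 C=\begin{bmatrix}0&0&1&0&0\\D(\alpha)Z^\top&0&0&0&0\end{bmatrix},$$ so that $\dot X=A(t)X+\bar u$ and $y=CX$. The Riccati observer is $$\dot{\hat X}=A(t)\hat X+\bar u+K(t)(y-C\hat X),\quad K=k\,PC^\top Q,\quad \dot P=AP+PA^\top-PC^\top QCP+V,\quad P(0)=P_0,$$ where $P_0$ is a symmetric positive definite matrix, $k:[0,\infty)\to[\tfrac12,\infty)$ is continuous, and $Q(t)\in\mathbb R^{(l+1)\times(l+1)}$, $V(t)\in\mathbb R^{(2n+3)\times(2n+3)}$ are symmetric, continuous and bounded on $[0,\infty)$, with $Q(t)\ge\varepsilon I$ and $V(t)\ge\varepsilon I$ for all $t\ge0$ and some $\varepsilon>0$. Assume that $u:[0,\infty)\to\mathbb R^n$ is bounded and twice differentiable with bounded first and second derivatives, and that for some $\delta>0$ and $\mu>0$ $$\forall t\ge 0:\quad ZD^\top(\alpha)D(\alpha)Z^\top+\frac1\delta\int_t^{t+\delta}\dot u(s)\dot u^\top(s)\,ds\ \ge\ \mu I_n .$$ Then the Riccati equation has a solution $P$ on $[0,\infty)$ with $P(0)=P_0$ and, for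 every such solution, the observer globally exponentially stabilizes the estimation error $\tilde X=X-\hat X$ at $0$. That is: for every bias $a$, every motion $x$ and every initial estimate $\hat X(0)$, the observer has a trajectory on $[0,\infty)$; and there are constants $c,r>0$, not depending on $a$, $x$, $\hat X(0)$, $t_0$ or $t$, such that $|\tilde X(t)|\le c\,e^{-r(t-t_0)}|\tilde X(t_0)|$ for all $t\ge t_0\ge0$ along every trajectory of the observer. -/

import Mathlib

noncomputable section

namespace RangeObserver

open scoped Matrix

/-- Ordinary Euclidean space `ℝⁿ`. -/
abbrev Vec (n : ℕ) := EuclideanSpace ℝ (Fin n)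

/-- Index set of the augmented state `(x, a, y₀, aᵀx, |a|²)`, of size `2n + 3`. -/
abbrev StateIdx (n : ℕ) := Fin n ⊕ Fin n ⊕ Fin 3

/-- Index set of the output, of size `1 + l`. -/
abbrev OutIdx (l : ℕ) := Fin 1 ⊕ Fin l

/-- The `n × l` matrix `Z = [z₁ … z_l]` whose columns are the source points. -/
def sourceMatrix {n l : ℕ} (z : Fin l → Vec n) : Matrix (Fin n) (Fin l) ℝ :=
  Matrix.of fun j i => z i j

/-- The `l × l` matrix `D(α) = ξ αᵀ - I`, where `ξ = (1, …, 1)ᵀ`. -/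
def weightMatrix {l : ℕ} (α : Fin l → ℝ) : Matrix (Fin l) (Fin l) ℝ :=
  Matrix.vecMulVec 1 α - 1

/-- The weighted source point `∑ αᵢ zᵢ`. -/
def weightedSource {n l : ℕ} (z : Fin l → Vec n) (α : Fin l → ℝ) : Vec n :=
  ∑ i, α i • z i

/-- The squared-range measurement `yᵢ = |x - zᵢ|² / 2`. -/
def rangeMeas {n l : ℕ} (z : Fin l → Vec n) (x : Vec n) (i : Fin l) : ℝ :=
  ‖x - z i‖ ^ 2 / 2

/-- The weighted output `y₀ = ∑ αᵢ (yᵢ - |zᵢ|² / 2)`. -/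
def weightedOutput {n l : ℕ} (z : Fin l → Vec n) (α : Fin l → ℝ) (x : Vec n) : ℝ :=
  ∑ i, α i * (rangeMeas z x i - ‖z i‖ ^ 2 / 2)

/-- The measured output `y = (y₀, y₁ - y₀ - |z₁|²/2, …, y_l - y₀ - |z_l|²/2)`. -/
def output {n l : ℕ} (z : Fin l → Vec n) (α : Fin l → ℝ) (x : Vec n) : OutIdx l → ℝ :=
  Sum.elim (fun _ => weightedOutput z α x)
    (fun j => rangeMeas z x j - weightedOutput z α x - ‖z j‖ ^ 2 / 2)

/-- The augmented state `X = (x, a, y₀, aᵀx, |a|²)`. -/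
def augState {n l : ℕ} (z : Fin l → Vec n) (α : Fin l → ℝ) (a x : Vec n) : StateIdx n → ℝ :=
  Sum.elim (fun j => x j)
    (Sum.elim (fun j => a j) ![weightedOutput z α x, inner ℝ a x, ‖a‖ ^ 2])

/-- The input `(u, 0, -uᵀ ∑ αᵢ zᵢ, 0, 0)` of the augmented system. -/
def augInput {n l : ℕ} (z : Fin l → Vec n) (α : Fin l → ℝ) (u : Vec n) : StateIdx n → ℝ :=
  Sum.elim (fun j => u j) (Sum.elim 0 ![-inner ℝ u (weightedSource z α), 0, 0])

/-- The state matrix of the augmented system. In the coordinates `(x, a, y₀, aᵀx, |a|²)` its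
block rows are `(0, I, 0, 0, 0)`, `(0, 0, 0, 0, 0)`, `(uᵀ, -∑ αᵢ zᵢᵀ, 0, 1, 0)`,
`(0, uᵀ, 0, 0, 1)` and `(0, 0, 0, 0, 0)`. -/
def stateMatrix {n l : ℕ} (z : Fin l → Vec n) (α : Fin l → ℝ) (u : Vec n) :
    Matrix (StateIdx n) (StateIdx n) ℝ :=
  Matrix.fromBlocks
    0
    (Matrix.fromCols 1 0)
    (Matrix.fromRows 0 (Matrix.of ![fun j => u j, 0, 0]))
    (Matrix.fromBlocks
      0
      0
      (Matrix.of ![fun j => -weightedSource z α j, fun j => u j, 0])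
      !![0, 1, 0; 0, 0, 1; 0, 0, 0])

/-- The output matrix of the augmented system, with block rows
`(0, 0, 1, 0, 0)` and `(D(α) Zᵀ, 0, 0, 0, 0)`. -/
def outputMatrix {n l : ℕ} (z : Fin l → Vec n) (α : Fin l → ℝ) :
    Matrix (OutIdx l) (StateIdx n) ℝ :=
  Matrix.fromBlocks
    0
    (Matrix.fromCols 0 !![1, 0, 0])
    (weightMatrix α * (sourceMatrix z)ᵀ)
    0

/-- `Z D(α)ᵀ D(α) Zᵀ + (1/δ) ∫_t^{t+δ} v(s) v(s)ᵀ ds`, the integral being taken entrywise. -/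
def excitationMatrix {n l : ℕ} (z : Fin l → Vec n) (α : Fin l → ℝ) (v : ℝ → Vec n)
    (δ t : ℝ) : Matrix (Fin n) (Fin n) ℝ :=
  sourceMatrix z * (weightMatrix α)ᵀ * weightMatrix α * (sourceMatrix z)ᵀ
    + (1 / δ) • Matrix.of fun i j => ∫ s in t..(t + δ), v s i * v s j

/-- `P` solves the continuous Riccati equation
`Ṗ = A P + P Aᵀ - P Cᵀ Q C P + V` on `[0, ∞)` (the derivative at `0` is one-sided). -/
def IsRiccatiSolution {ι κ : Type*} [Fintype ι] [Fintype κ]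
    (A : ℝ → Matrix ι ι ℝ) (C : Matrix κ ι ℝ) (Q : ℝ → Matrix κ κ ℝ) (V : ℝ → Matrix ι ι ℝ)
    (P : ℝ → Matrix ι ι ℝ) : Prop :=
  ∀ t, 0 ≤ t → ∀ i j, HasDerivWithinAt (fun s => P s i j)
    ((A t * P t + P t * (A t)ᵀ - P t * Cᵀ * Q t * C * P t + V t) i j) (Set.Ici 0) t

/-- The observer gain `K = k P Cᵀ Q`. -/
def riccatiGain {ι κ : Type*} [Fintype ι] [Fintype κ]
    (k : ℝ → ℝ) (P : ℝ → Matrix ι ι ℝ) (C : Matrix κ ι ℝ) (Q : ℝ → Matrix κ κ ℝ) (t : ℝ) :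
    Matrix ι κ ℝ :=
  k t • (P t * Cᵀ * Q t)

/-- `Xhat` is a trajectory on `[0, ∞)` of the observer
`Ẋhat = A Xhat + b + K (y - C Xhat)`. -/
def IsObserverTrajectory {ι κ : Type*} [Fintype ι] [Fintype κ]
    (A : ℝ → Matrix ι ι ℝ) (b : ℝ → ι → ℝ) (K : ℝ → Matrix ι κ ℝ) (C : Matrix κ ι ℝ)
    (y : ℝ → κ → ℝ) (Xhat : ℝ → ι → ℝ) : Prop :=
  ∀ t, 0 ≤ t → HasDerivWithinAt Xhat
    (A t *ᵥ Xhat t + b t + K t *ᵥ (y t - C *ᵥ Xhat t)) (Set.Ici 0) t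

/-- `x` is a motion on `[0, ∞)` of the body with measured velocity `u` and constant velocity
bias `a`, that is `ẋ = u + a`. -/
def IsBodyMotion {n : ℕ} (u : ℝ → Vec n) (a : Vec n) (x : ℝ → Vec n) : Prop :=
  ∀ t, 0 ≤ t → HasDerivWithinAt x (u t + a) (Set.Ici 0) t

/-- The Euclidean norm of a finite family of reals. -/
def euclNorm {ι : Type*} [Fintype ι] (v : ι → ℝ) : ℝ :=
  ‖WithLp.toLp 2 v‖

/-- The Riccati observer with gain `K` globally exponentially stabilizes the estimation error
`X - Xhat` at zero: for every bias, every motion of the body and every initial estimate the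
observer has a trajectory on `[0, ∞)`, and along all of its trajectories the error decays
exponentially, with constants that depend neither on the bias, nor on the motion, nor on the
initial estimate, nor on the initial time. -/
def GloballyExpStabilizes {n l : ℕ} (z : Fin l → Vec n) (α : Fin l → ℝ) (u : ℝ → Vec n)
    (K : ℝ → Matrix (StateIdx n) (OutIdx l) ℝ) : Prop :=
  (∀ (a : Vec n) (x : ℝ → Vec n), IsBodyMotion u a x → ∀ X₀ : StateIdx n → ℝ,
    ∃ Xhat : ℝ → StateIdx n → ℝ, Xhat 0 = X₀ ∧
      IsObserverTrajectory (fun t => stateMatrix z α (u t)) (fun t => augInput z α (u t)) K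
        (outputMatrix z α) (fun t => output z α (x t)) Xhat) ∧
  ∃ c > 0, ∃ r > 0, ∀ (a : Vec n) (x : ℝ → Vec n), IsBodyMotion u a x →
    ∀ Xhat : ℝ → StateIdx n → ℝ,
      IsObserverTrajectory (fun t => stateMatrix z α (u t)) (fun t => augInput z α (u t)) K
        (outputMatrix z α) (fun t => output z α (x t)) Xhat →
      ∀ t₀ t, 0 ≤ t₀ → t₀ ≤ t →
        euclNorm (augState z α a (x t) - Xhat t)
          ≤ c * Real.exp (-r * (t - t₀)) * euclNorm (augState z α a (x t₀) - Xhat t₀)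

end RangeObserver

end

/-! Because the weights sum to one, differences of squared ranges are linear in the position, and
the quadratic quantities `⟪a, x⟫` and `‖a‖ ^ 2` produced by differentiating `y₀` are adjoined as
coordinates with linear equations of their own. The augmented state thus solves its linear equation
exactly, and the error obeys `ė = (A - k P S) e` with `S = Cᵀ Q C`. It remains to solve the Riccati
equation, to bound `P` above and below, and to deduce exponential decay.

All of the Riccati theory rests on one identity. Along the Hamiltonian system `ṗ = -Aᵀ p + S x`, `ẋ
= A x + V p` the pairing `p ⬝ᵥ x` has derivative `x ⬝ᵥ S x + p ⬝ᵥ V p ≥ 0`. It rules out finite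
escape (`exists_isRiccatiSolution`) and, with `x = P p`, turns the form of `P` at a given time into
accumulated energy. Positivity of `V` gives the lower bound (`exists_lower_bound`), uniform
observability of `(A, C)` the upper bound (`exists_upper_bound`). Decay follows by duality
(`exists_exp_bound`): the adjoint of the error equation grows in the norm of `P` when `k ≥ 1 / 2`.

Observability (`exists_window_bound`) uses the excitation. In the free system `a` and `b` are
constant, the position runs along the line `x + (s - t) a`, and `y'' = ⟪u', x + (s - t) a⟫ + 2 ⟪u,
a⟫ + b`. Small output energy makes `y`, `y'` and `y''` small up to a small multiple of the state,
since one further derivative is bounded (`exists_output_bound`). Viewed from a point `ξ` of the line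
far larger than `a`, smallness of `y''` says that `⟪u', ξ⟫ + b` is nearly zero. As `u` is bounded,
`⟪u', ξ⟫` has small mean over long windows, so `b` is small relative to `ξ`, and the excitation
condition then makes `ξ` small (`exists_line_bound`). -/

namespace RangeObserver

open Matrix Set

/-! ### Global solutions of linear differential equations. -/

/-- Coordinatewise truncation to `[-R, R]`. -/
def clamp {κ : Type*} (R : ℝ) (x : κ → ℝ) : κ → ℝ := fun i => max (-R) (min R (x i))

theorem norm_clamp_le {κ : Type*} [Fintype κ] {R : ℝ} (hR : 0 ≤ R) (x : κ → ℝ) :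
    ‖clamp R x‖ ≤ R := by
  refine (pi_norm_le_iff_of_nonneg hR).2 fun i => ?_
  rw [Real.norm_eq_abs, abs_le]
  exact ⟨le_max_left _ _, max_le (by linarith) (min_le_left _ _)⟩

theorem norm_clamp_le_norm {κ : Type*} [Fintype κ] {R : ℝ} (hR : 0 ≤ R) (x : κ → ℝ) :
    ‖clamp R x‖ ≤ ‖x‖ := by
  refine (pi_norm_le_iff_of_nonneg (norm_nonneg x)).2 fun i => ?_
  have h := norm_le_pi_norm x i
  rw [Real.norm_eq_abs, abs_le] at h ⊢
  have h0 := norm_nonneg x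
  refine ⟨le_max_of_le_right (le_min (by linarith) h.1),
    max_le (by linarith) ((min_le_right _ _).trans h.2)⟩

theorem clamp_eq_self {κ : Type*} [Fintype κ] {R : ℝ} {x : κ → ℝ} (hx : ‖x‖ ≤ R) :
    clamp R x = x := by
  funext i
  have h := (norm_le_pi_norm x i).trans hx
  rw [Real.norm_eq_abs, abs_le] at h
  simp [clamp, min_eq_right h.2, max_eq_right h.1]

theorem norm_clamp_sub_le {κ : Type*} [Fintype κ] (R : ℝ) (x y : κ → ℝ) :
    ‖clamp R x - clamp R y‖ ≤ ‖x - y‖ := by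
  refine (pi_norm_le_iff_of_nonneg (norm_nonneg _)).2 fun i => ?_
  refine le_trans ?_ (norm_le_pi_norm (x - y) i)
  simp only [clamp, Pi.sub_apply, Real.norm_eq_abs]
  refine (abs_max_sub_max_le_max _ _ _ _).trans ?_
  refine max_le (by simp) ((abs_min_sub_min_le_max _ _ _ _).trans ?_)
  exact max_le (by simp) le_rfl

section
attribute [local instance] Matrix.linftyOpNormedAddCommGroup

theorem exists_bound_mulVec {κ ι : Type*} [Fintype κ] [Fintype ι] {M : ℝ → Matrix ι κ ℝ}
    {s : Set ℝ} (hs : IsCompact s) (hM : ContinuousOn M s) :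
    ∃ K, 0 ≤ K ∧ ∀ t ∈ s, ∀ v, ‖M t *ᵥ v‖ ≤ K * ‖v‖ := by
  obtain ⟨K, hK⟩ := hs.exists_bound_of_continuousOn hM
  refine ⟨max K 0, le_max_right _ _, fun t ht v => (linfty_opNorm_mulVec _ _).trans ?_⟩
  gcongr
  exact (hK t ht).trans (le_max_left _ _)

end

theorem norm_le_of_affine_bound {κ : Type*} [Fintype κ] {x f : ℝ → κ → ℝ} {K c T t₀ : ℝ}
    (hx : ∀ t ∈ Icc (t₀ - T) (t₀ + T), HasDerivWithinAt x (f t) (Icc (t₀ - T) (t₀ + T)) t)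
    (hf : ∀ t ∈ Icc (t₀ - T) (t₀ + T), ‖f t‖ ≤ K * ‖x t‖ + c)
    (hK : 0 ≤ K) (hc : 0 ≤ c) :
    ∀ t ∈ Icc (t₀ - T) (t₀ + T), ‖x t‖ ≤ gronwallBound ‖x t₀‖ K c T := by
  -- Grönwall's inequality runs forward in time only; `σ = -1` reverses time to cover the half
  -- before `t₀`.
  have key : ∀ σ : ℝ, (σ = 1 ∨ σ = -1) → ∀ r ∈ Icc 0 T,
      ‖x (t₀ + σ * r)‖ ≤ gronwallBound ‖x t₀‖ K c T := by
    intro σ hσ r hr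
    have hmem : ∀ r ∈ Icc 0 T, t₀ + σ * r ∈ Icc (t₀ - T) (t₀ + T) := by
      intro r hr
      rcases hσ with rfl | rfl <;> constructor <;> linarith [hr.1, hr.2]
    have hd : ∀ r ∈ Icc 0 T, HasDerivWithinAt (fun r => x (t₀ + σ * r))
        (σ • f (t₀ + σ * r)) (Icc 0 T) r := by
      intro r hr
      have h1 : HasDerivWithinAt (fun r => t₀ + σ * r) σ (Icc 0 T) r := by
        simpa using ((hasDerivWithinAt_id r (Icc 0 T)).const_mul σ).const_add t₀
      exact (hx _ (hmem r hr)).scomp r h1 hmem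
    have hσ1 : ‖σ‖ = 1 := by rcases hσ with rfl | rfl <;> simp
    have := norm_le_gronwallBound_of_norm_deriv_right_le (f := fun r => x (t₀ + σ * r))
      (f' := fun r => σ • f (t₀ + σ * r)) (δ := ‖x t₀‖) (K := K) (ε := c) (a := 0) (b := T)
      (fun r hr => (hd r hr).continuousWithinAt)
      (fun r hr => (hd r ⟨hr.1, hr.2.le⟩).mono_of_mem_nhdsWithin
        (Icc_mem_nhdsGE_of_mem hr))
      (by simp) (fun r hr => by
        rw [norm_smul, hσ1, one_mul]; exact hf _ (hmem r ⟨hr.1, hr.2.le⟩)) r hr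
    exact this.trans (gronwallBound_mono (norm_nonneg _) hc hK (by linarith [hr.2]))
  intro t ht
  rcases le_total t₀ t with h | h
  · simpa using key 1 (Or.inl rfl) (t - t₀) ⟨by linarith, by linarith [ht.2]⟩
  · simpa using key (-1) (Or.inr rfl) (t₀ - t) ⟨by linarith, by linarith [ht.1]⟩

/-- Picard–Lindelöf covers an interval of prescribed length if the field is bounded on a ball whose
radius is that bound times the length. Truncating the state at the Grönwall a priori bound `R` makes
the field bounded everywhere, and the solution of the truncated equation satisfies the same a priori
bound, so the truncation is never active. -/
theorem exists_linear_solution_Icc {κ : Type*} [Fintype κ] {M : ℝ → Matrix κ κ ℝ}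
    {b : ℝ → κ → ℝ} (hM : Continuous M) (hb : Continuous b) (t₀ : ℝ) {T : ℝ} (hT : 0 < T)
    (v : κ → ℝ) :
    ∃ x : ℝ → κ → ℝ, x t₀ = v ∧ ∀ t ∈ Icc (t₀ - T) (t₀ + T),
      HasDerivWithinAt x (M t *ᵥ x t + b t) (Icc (t₀ - T) (t₀ + T)) t := by
  obtain ⟨K, hK0, hK⟩ := exists_bound_mulVec (isCompact_Icc (a := t₀ - T) (b := t₀ + T))
    hM.continuousOn
  obtain ⟨c', hc'⟩ := (isCompact_Icc (a := t₀ - T) (b := t₀ + T)).exists_bound_of_continuousOn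
    hb.continuousOn
  set c := max c' 0
  have hc0 : 0 ≤ c := le_max_right _ _
  have hc : ∀ t ∈ Icc (t₀ - T) (t₀ + T), ‖b t‖ ≤ c := fun t ht =>
    (hc' t ht).trans (le_max_left _ _)
  set R := gronwallBound ‖v‖ K c T
  have hR : 0 ≤ R := by
    have := gronwallBound_mono (norm_nonneg v) hc0 hK0 hT.le
    rw [gronwallBound_x0] at this
    exact (norm_nonneg v).trans this
  have ht₀ : t₀ ∈ Icc (t₀ - T) (t₀ + T) := ⟨by linarith, by linarith⟩
  have hPL : IsPicardLindelof (fun t x => M t *ᵥ clamp R x + b t)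
      (⟨t₀, ht₀⟩ : Icc (t₀ - T) (t₀ + T)) v (Real.toNNReal ((K * R + c) * T)) 0
      (Real.toNNReal (K * R + c)) (Real.toNNReal K) := by
    have h1 : 0 ≤ K * R + c := by positivity
    refine ⟨fun t ht => ?_, fun x _ => ?_, fun t ht x _ => ?_, ?_⟩
    · refine LipschitzOnWith.of_dist_le_mul fun x _ y _ => ?_
      rw [dist_add_right, dist_eq_norm, dist_eq_norm, ← mulVec_sub, Real.coe_toNNReal _ hK0]
      exact (hK t ht _).trans (by gcongr; exact norm_clamp_sub_le R x y)
    · exact ((hM.matrix_mulVec continuous_const).add hb).continuousOn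
    · rw [Real.coe_toNNReal _ h1]
      refine (norm_add_le _ _).trans (add_le_add ((hK t ht _).trans ?_) (hc t ht))
      gcongr
      exact norm_clamp_le hR x
    · simp [Real.coe_toNNReal _ h1, Real.coe_toNNReal _ (mul_nonneg h1 hT.le)]
  obtain ⟨x, hx0, hx⟩ := hPL.exists_eq_forall_mem_Icc_hasDerivWithinAt₀
  simp only at hx0
  have hbound : ∀ t ∈ Icc (t₀ - T) (t₀ + T), ‖x t‖ ≤ R := by
    have := norm_le_of_affine_bound hx (K := K) (c := c) (fun t ht =>
      (norm_add_le _ _).trans (add_le_add ((hK t ht _).trans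
        (mul_le_mul_of_nonneg_left (norm_clamp_le_norm hR _) hK0)) (hc t ht))) hK0 hc0
    rwa [hx0] at this
  refine ⟨x, hx0, fun t ht => ?_⟩
  have := hx t ht
  rwa [clamp_eq_self (hbound t ht)] at this

theorem exists_linear_solution_real {κ : Type*} [Fintype κ] {M : ℝ → Matrix κ κ ℝ}
    {b : ℝ → κ → ℝ} (hM : Continuous M) (hb : Continuous b) (t₀ : ℝ) (v : κ → ℝ) :
    ∃ x : ℝ → κ → ℝ, x t₀ = v ∧ ∀ t, HasDerivAt x (M t *ᵥ x t + b t) t := by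
  choose X hX0 hX using fun m : ℕ =>
    exists_linear_solution_Icc hM hb t₀ (T := (m : ℝ) + 1) (by positivity) v
  have hXd : ∀ m : ℕ, ∀ t ∈ Ioo (t₀ - (m + 1)) (t₀ + (m + 1)),
      HasDerivAt (X m) (M t *ᵥ X m t + b t) t := fun m t ht =>
    (hX m t ⟨ht.1.le, ht.2.le⟩).hasDerivAt (Icc_mem_nhds ht.1 ht.2)
  have hEq : ∀ m m' : ℕ, m ≤ m' → EqOn (X m) (X m') (Icc (t₀ - (m + 1)) (t₀ + (m + 1))) := by
    intro m m' hmm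
    have hcast : (m : ℝ) ≤ m' := by exact_mod_cast hmm
    have hsub : Icc (t₀ - ((m : ℝ) + 1)) (t₀ + (m + 1)) ⊆ Icc (t₀ - (m' + 1)) (t₀ + (m' + 1)) :=
      Icc_subset_Icc (by linarith) (by linarith)
    obtain ⟨K, hK0, hK⟩ := exists_bound_mulVec
      (isCompact_Icc (a := t₀ - ((m : ℝ) + 1)) (b := t₀ + (m + 1))) hM.continuousOn
    refine ODE_solution_unique_of_mem_Icc (v := fun t x => M t *ᵥ x + b t) (s := fun _ => univ)
      (K := Real.toNNReal K) (t₀ := t₀) ?_ ⟨by linarith, by linarith⟩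
      (fun t ht => (hX m t ht).continuousWithinAt) (hXd m) (fun _ _ => mem_univ _)
      (fun t ht => ((hX m' t (hsub ht)).continuousWithinAt).mono hsub)
      (fun t ht => hXd m' t ⟨by linarith [ht.1], by linarith [ht.2]⟩) (fun _ _ => mem_univ _)
      (by rw [hX0, hX0])
    intro t ht
    refine LipschitzOnWith.of_dist_le_mul fun x _ y _ => ?_
    rw [dist_add_right, dist_eq_norm, dist_eq_norm, ← mulVec_sub, Real.coe_toNNReal _ hK0]
    exact hK t ⟨ht.1.le, ht.2.le⟩ _
  -- `X m` lives on radius `m + 1`, one more than its index requires, so near `t` all the pieces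
  -- involved agree with a single `X m`.
  refine ⟨fun t => X ⌈|t - t₀|⌉₊ t, by simpa using hX0 0, fun t => ?_⟩
  set m := ⌈|t - t₀|⌉₊ + 1 with hm
  have hlt : |t - t₀| < m := by
    have := Nat.le_ceil |t - t₀|
    rw [hm]; push_cast; linarith
  have hev : (fun s => X ⌈|s - t₀|⌉₊ s) =ᶠ[nhds t] X m := by
    have : ∀ᶠ s in nhds t, |s - t₀| < m :=
      (by fun_prop : Continuous fun s : ℝ => |s - t₀|).continuousAt.eventually_lt
        continuousAt_const hlt
    filter_upwards [this] with s hs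
    refine hEq _ m (Nat.ceil_le.2 hs.le) ?_
    have h2 := abs_le.1 (Nat.le_ceil |s - t₀|)
    constructor <;> linarith [h2.1, h2.2]
  have h3 := abs_lt.1 hlt
  have := hXd m t ⟨by linarith, by linarith⟩
  rw [hev.hasDerivAt_iff]
  have h4 : (fun s => X ⌈|s - t₀|⌉₊ s) t = X m t := hev.eq_of_nhds
  rw [h4]
  exact this

/-- Linear equations with continuous coefficients on `[0, ∞)` have solutions on `[0, ∞)`, with a
prescribed value at any time of the half-line. -/
theorem exists_linear_solution {κ : Type*} [Fintype κ] {M : ℝ → Matrix κ κ ℝ}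
    {b : ℝ → κ → ℝ} (hM : ContinuousOn M (Ici 0)) (hb : ContinuousOn b (Ici 0)) (t₀ : ℝ)
    (v : κ → ℝ) :
    ∃ x : ℝ → κ → ℝ, x t₀ = v ∧
      ∀ t, 0 ≤ t → HasDerivWithinAt x (M t *ᵥ x t + b t) (Ici 0) t := by
  -- Precomposition with `max 0` freezes the coefficients at their initial value for negative times,
  -- which reduces the claim to the whole line.
  have hmax : Continuous fun t : ℝ => max 0 t := by fun_prop
  have hmem : ∀ t : ℝ, max 0 t ∈ Ici (0 : ℝ) := fun t => mem_Ici.2 (le_max_left _ _)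
  obtain ⟨x, hx0, hx⟩ := exists_linear_solution_real (hM.comp_continuous hmax hmem)
    (hb.comp_continuous hmax hmem) t₀ v
  refine ⟨x, hx0, fun t ht => ?_⟩
  have := (hx t).hasDerivWithinAt (s := Ici 0)
  simpa only [Function.comp_apply, max_eq_right ht] using this

/-! ### Monotonicity and mean values for derivatives within the half-line. -/

theorem le_of_hasDerivWithinAt_nonneg {f f' : ℝ → ℝ} {a b : ℝ} (ha : 0 ≤ a) (hab : a ≤ b)
    (hf : ∀ t ∈ Icc a b, HasDerivWithinAt f (f' t) (Ici 0) t)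
    (hf' : ∀ t ∈ Icc a b, 0 ≤ f' t) : f a ≤ f b := by
  refine monotoneOn_of_hasDerivWithinAt_nonneg (f := f) (f' := f') (convex_Icc a b)
    (fun t ht => ((hf t ht).continuousWithinAt).mono fun s hs => ha.trans hs.1) ?_ ?_
    (left_mem_Icc.2 hab) (right_mem_Icc.2 hab) hab
  · intro t ht
    rw [interior_Icc] at ht ⊢
    exact (hf t ⟨ht.1.le, ht.2.le⟩).mono fun s hs => ha.trans hs.1.le
  · intro t ht
    rw [interior_Icc] at ht
    exact hf' t ⟨ht.1.le, ht.2.le⟩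

theorem le_of_hasDerivWithinAt_le {f f' g g' : ℝ → ℝ} {a b : ℝ} (ha : 0 ≤ a) (hab : a ≤ b)
    (hf : ∀ t ∈ Icc a b, HasDerivWithinAt f (f' t) (Ici 0) t)
    (hg : ∀ t ∈ Icc a b, HasDerivWithinAt g (g' t) (Ici 0) t)
    (hfg : ∀ t ∈ Icc a b, f' t ≤ g' t) : f b - f a ≤ g b - g a := by
  have := le_of_hasDerivWithinAt_nonneg (f := fun t => g t - f t) (f' := fun t => g' t - f' t)
    ha hab (fun t ht => (hg t ht).sub (hf t ht)) (fun t ht => sub_nonneg.2 (hfg t ht))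
  linarith

theorem eq_of_hasDerivWithinAt_zero {f : ℝ → ℝ} {a b : ℝ} (ha : 0 ≤ a) (hab : a ≤ b)
    (hf : ∀ t ∈ Icc a b, HasDerivWithinAt f 0 (Ici 0) t) : f a = f b := by
  refine le_antisymm (le_of_hasDerivWithinAt_nonneg ha hab hf fun _ _ => le_rfl) ?_
  have := le_of_hasDerivWithinAt_nonneg ha hab (f := -f) (f' := fun _ => 0)
    (fun t ht => by simpa using (hf t ht).neg) fun _ _ => le_rfl
  simpa using this

theorem exists_hasDerivWithinAt_eq_slope {f f' : ℝ → ℝ} {a b : ℝ} (ha : 0 ≤ a) (hab : a < b)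
    (hf : ∀ t ∈ Icc a b, HasDerivWithinAt f (f' t) (Ici 0) t) :
    ∃ s ∈ Ioo a b, f' s = (f b - f a) / (b - a) :=
  exists_hasDerivAt_eq_slope f f' hab
    (fun t ht => ((hf t ht).continuousWithinAt).mono fun _ hs => ha.trans hs.1)
    fun t ht => (hf t ⟨ht.1.le, ht.2.le⟩).hasDerivAt (Ici_mem_nhds (ha.trans_lt ht.1))

theorem hasDerivWithinAt_dotProduct {ι : Type*} [Fintype ι] {f g : ℝ → ι → ℝ} {f' g' : ι → ℝ} {s : Set ℝ} {t : ℝ}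
    (hf : HasDerivWithinAt f f' s t) (hg : HasDerivWithinAt g g' s t) :
    HasDerivWithinAt (fun r => f r ⬝ᵥ g r) (f' ⬝ᵥ g t + f t ⬝ᵥ g') s t := by
  rw [hasDerivWithinAt_pi] at hf hg
  have := HasDerivWithinAt.fun_sum (u := Finset.univ) fun i _ => (hf i).mul (hg i)
  simp only [Finset.sum_add_distrib] at this
  exact this

theorem hasDerivWithinAt_mulVec {ι κ : Type*} [Fintype κ] {P : ℝ → Matrix ι κ ℝ} {P' : Matrix ι κ ℝ} {g : ℝ → κ → ℝ}
    {g' : κ → ℝ} {s : Set ℝ} {t : ℝ}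
    (hP : ∀ i j, HasDerivWithinAt (fun r => P r i j) (P' i j) s t)
    (hg : HasDerivWithinAt g g' s t) :
    HasDerivWithinAt (fun r => P r *ᵥ g r) (P' *ᵥ g t + P t *ᵥ g') s t := by
  rw [hasDerivWithinAt_pi]
  intro i
  exact hasDerivWithinAt_dotProduct (hasDerivWithinAt_pi.2 (hP i)) hg

theorem hasDerivWithinAt_const_mulVec {ι κ : Type*} [Fintype κ] (C : Matrix ι κ ℝ) {g : ℝ → κ → ℝ}
    {g' : κ → ℝ} {s : Set ℝ} {t : ℝ} (hg : HasDerivWithinAt g g' s t) :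
    HasDerivWithinAt (fun r => C *ᵥ g r) (C *ᵥ g') s t := by
  simpa using hasDerivWithinAt_mulVec (P := fun _ => C) (P' := 0)
    (fun i j => hasDerivWithinAt_const _ _ _) hg

/-! ### Quadratic forms and matrix bounds. -/

section Quadratic

variable {ι κ : Type*} [Fintype ι] [Fintype κ]

theorem dotProduct_self_nonneg (v : ι → ℝ) : 0 ≤ v ⬝ᵥ v :=
  Finset.sum_nonneg fun i _ => mul_self_nonneg (v i)

theorem two_mul_dotProduct_le (v w : ι → ℝ) : 2 * (v ⬝ᵥ w) ≤ v ⬝ᵥ v + w ⬝ᵥ w := by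
  have := dotProduct_self_nonneg (v - w)
  simp only [sub_dotProduct, dotProduct_sub, dotProduct_comm w v] at this
  linarith

theorem neg_two_mul_dotProduct_le (v w : ι → ℝ) : -(2 * (v ⬝ᵥ w)) ≤ v ⬝ᵥ v + w ⬝ᵥ w := by
  have := two_mul_dotProduct_le (-v) w
  simp only [neg_dotProduct, dotProduct_neg, neg_neg] at this
  linarith

theorem dotProduct_self_add_le (v w : ι → ℝ) :
    (v + w) ⬝ᵥ (v + w) ≤ 2 * (v ⬝ᵥ v) + 2 * (w ⬝ᵥ w) := by
  have := two_mul_dotProduct_le v w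
  simp only [add_dotProduct, dotProduct_add, dotProduct_comm w v]
  linarith

theorem dotProduct_self_sub_le (v w : ι → ℝ) :
    (v - w) ⬝ᵥ (v - w) ≤ 2 * (v ⬝ᵥ v) + 2 * (w ⬝ᵥ w) := by
  have := neg_two_mul_dotProduct_le v w
  simp only [sub_dotProduct, dotProduct_sub, dotProduct_comm w v]
  linarith

theorem dotProduct_sq_le (v w : ι → ℝ) : (v ⬝ᵥ w) ^ 2 ≤ (v ⬝ᵥ v) * (w ⬝ᵥ w) := by
  have := Finset.sum_mul_sq_le_sq_mul_sq Finset.univ v w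
  simpa only [dotProduct, pow_two] using this

theorem exists_dotProduct_self_mulVec_le (ι κ : Type*) [Fintype ι] [Fintype κ] (B : ℝ) :
    ∃ K > 0, ∀ M : Matrix ι κ ℝ, (∀ i j, |M i j| ≤ B) →
      ∀ v, (M *ᵥ v) ⬝ᵥ (M *ᵥ v) ≤ K * (v ⬝ᵥ v) := by
  refine ⟨(Fintype.card ι : ℝ) * (Fintype.card κ * B ^ 2) + 1, by positivity,
    fun M hM v => ?_⟩
  have h0 := dotProduct_self_nonneg v
  have h1 : ∀ i, (M *ᵥ v) i * (M *ᵥ v) i ≤ (Fintype.card κ * B ^ 2) * (v ⬝ᵥ v) := by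
    intro i
    have h2 := dotProduct_sq_le (M i) v
    have h3 : M i ⬝ᵥ M i ≤ Fintype.card κ * B ^ 2 := by
      calc M i ⬝ᵥ M i ≤ ∑ _j : κ, B ^ 2 := Finset.sum_le_sum fun j _ => by
            rw [← pow_two]; exact sq_le_sq' (abs_le.1 (hM i j)).1 (abs_le.1 (hM i j)).2
        _ = _ := by simp
    rw [← pow_two]
    exact h2.trans (by gcongr)
  calc (M *ᵥ v) ⬝ᵥ (M *ᵥ v) ≤ ∑ _i : ι, (Fintype.card κ * B ^ 2) * (v ⬝ᵥ v) :=
        Finset.sum_le_sum fun i _ => h1 i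
    _ = (Fintype.card ι : ℝ) * (Fintype.card κ * B ^ 2) * (v ⬝ᵥ v) := by simp; ring
    _ ≤ _ := by nlinarith

theorem exists_dotProduct_self_mulVec_le_of_bounded {M : ℝ → Matrix ι κ ℝ} {s : Set ℝ}
    (hM : ∃ B, ∀ t ∈ s, ∀ i j, |M t i j| ≤ B) :
    ∃ K > 0, ∀ t ∈ s, ∀ v, (M t *ᵥ v) ⬝ᵥ (M t *ᵥ v) ≤ K * (v ⬝ᵥ v) := by
  obtain ⟨B, hB⟩ := hM
  obtain ⟨K, hK, h⟩ := exists_dotProduct_self_mulVec_le ι κ B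
  exact ⟨K, hK, fun t ht => h (M t) (hB t ht)⟩

theorem exists_bound_of_continuousOn_matrix {M : ℝ → Matrix ι κ ℝ} {s : Set ℝ}
    (hs : IsCompact s) (hM : ContinuousOn M s) : ∃ B, ∀ t ∈ s, ∀ i j, |M t i j| ≤ B := by
  obtain ⟨B, hB⟩ := hs.exists_bound_of_continuousOn (f := fun t i j => M t i j) hM
  refine ⟨B, fun t ht i j => ?_⟩
  exact ((norm_le_pi_norm (M t i) j).trans (norm_le_pi_norm (M t) i)).trans (hB t ht)

theorem mul_dotProduct_self_le_of_posSemidef [DecidableEq ι] {M : Matrix ι ι ℝ} {ε : ℝ}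
    (h : (M - ε • (1 : Matrix ι ι ℝ)).PosSemidef) (v : ι → ℝ) :
    ε * (v ⬝ᵥ v) ≤ v ⬝ᵥ (M *ᵥ v) := by
  have := h.dotProduct_mulVec_nonneg v
  simp only [star_trivial, sub_mulVec, smul_mulVec, one_mulVec, dotProduct_sub,
    dotProduct_smul, smul_eq_mul] at this
  linarith

end Quadratic

theorem transpose_eq_of_sub_smul_one_posSemidef {ι : Type*} [DecidableEq ι] {M : Matrix ι ι ℝ} {ε : ℝ}
    (h : (M - ε • (1 : Matrix ι ι ℝ)).PosSemidef) : Mᵀ = M := by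
  have h1 := h.isHermitian
  rw [IsHermitian, conjTranspose_eq_transpose_of_trivial] at h1
  simpa using h1

/-! ### Existence for the Riccati equation by linearization. -/

section RiccatiExistence

variable {ι κ : Type*} [Fintype ι] [Fintype κ] [DecidableEq ι]

theorem exists_hamiltonian_solution {A S V : ℝ → Matrix ι ι ℝ}
    (hA : ContinuousOn A (Ici 0)) (hS : ContinuousOn S (Ici 0)) (hV : ContinuousOn V (Ici 0))
    (P₀ : Matrix ι ι ℝ) :
    ∃ X Y : ℝ → Matrix ι ι ℝ, X 0 = 1 ∧ Y 0 = P₀ ∧ ∀ t, 0 ≤ t →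
      HasDerivWithinAt X (-(A t)ᵀ * X t + S t * Y t) (Ici 0) t ∧
      HasDerivWithinAt Y (V t * X t + A t * Y t) (Ici 0) t := by
  have hH : ContinuousOn (fun t => Matrix.fromBlocks (-(A t)ᵀ) (S t) (V t) (A t)) (Ici 0) := by
    rw [continuousOn_iff_continuous_domRestrict] at *
    exact Continuous.matrix_fromBlocks hA.matrix_transpose.neg hS hV hA
  choose h h0 hd using fun j : ι => exists_linear_solution hH
    (b := fun _ => 0) continuousOn_const 0 (Sum.elim (Pi.single j 1) (P₀.col j))
  refine ⟨fun t => Matrix.of fun i j => h j t (Sum.inl i),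
    fun t => Matrix.of fun i j => h j t (Sum.inr i), ?_, ?_, fun t ht => ⟨?_, ?_⟩⟩
  · ext i j
    simp [h0, Pi.single_apply, Matrix.one_apply]
  · ext i j
    simp [h0]
  · refine hasDerivWithinAt_pi.2 fun i => hasDerivWithinAt_pi.2 fun j => ?_
    have := hasDerivWithinAt_pi.1 (hd j t ht) (Sum.inl i)
    simpa [Matrix.mulVec, dotProduct, Fintype.sum_sum_type, Matrix.mul_apply] using this
  · refine hasDerivWithinAt_pi.2 fun i => hasDerivWithinAt_pi.2 fun j => ?_
    have := hasDerivWithinAt_pi.1 (hd j t ht) (Sum.inr i)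
    simpa [Matrix.mulVec, dotProduct, Fintype.sum_sum_type, Matrix.mul_apply] using this

/-- If `X t` killed `w ≠ 0`, the pairing of `X w` with `Y w`, which never decreases, would go from
`w ⬝ᵥ P₀ w > 0` to `0`. -/
theorem isUnit_of_hamiltonian {A S V X Y : ℝ → Matrix ι ι ℝ} {P₀ : Matrix ι ι ℝ}
    (hP₀ : P₀.PosDef)
    (hS : ∀ t, 0 ≤ t → ∀ v, 0 ≤ v ⬝ᵥ (S t *ᵥ v)) (hV : ∀ t, 0 ≤ t → ∀ v, 0 ≤ v ⬝ᵥ (V t *ᵥ v))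
    (hX₀ : X 0 = 1) (hY₀ : Y 0 = P₀)
    (hX : ∀ t, 0 ≤ t → HasDerivWithinAt X (-(A t)ᵀ * X t + S t * Y t) (Ici 0) t)
    (hY : ∀ t, 0 ≤ t → HasDerivWithinAt Y (V t * X t + A t * Y t) (Ici 0) t)
    {t : ℝ} (ht : 0 ≤ t) : IsUnit (X t) := by
  rw [Matrix.isUnit_iff_isUnit_det, isUnit_iff_ne_zero]
  intro hdet
  obtain ⟨w, hw, hXw⟩ := Matrix.exists_mulVec_eq_zero_iff.2 hdet
  have hdX : ∀ s, 0 ≤ s → HasDerivWithinAt (fun s => X s *ᵥ w)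
      ((-(A s)ᵀ * X s + S s * Y s) *ᵥ w) (Ici 0) s := fun s hs => by
    simpa using hasDerivWithinAt_mulVec
      (fun i j => hasDerivWithinAt_pi.1 (hasDerivWithinAt_pi.1 (hX s hs) i) j)
      (hasDerivWithinAt_const s (Ici 0) w)
  have hdY : ∀ s, 0 ≤ s → HasDerivWithinAt (fun s => Y s *ᵥ w)
      ((V s * X s + A s * Y s) *ᵥ w) (Ici 0) s := fun s hs => by
    simpa using hasDerivWithinAt_mulVec
      (fun i j => hasDerivWithinAt_pi.1 (hasDerivWithinAt_pi.1 (hY s hs) i) j)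
      (hasDerivWithinAt_const s (Ici 0) w)
  have hmono := le_of_hasDerivWithinAt_nonneg le_rfl ht
    (fun s hs => hasDerivWithinAt_dotProduct (hdX s hs.1) (hdY s hs.1)) (fun s hs => by
      have h1 := hS s hs.1 (Y s *ᵥ w)
      have h2 := hV s hs.1 (X s *ᵥ w)
      have h3 : ((A s)ᵀ *ᵥ (X s *ᵥ w)) ⬝ᵥ (Y s *ᵥ w) = (X s *ᵥ w) ⬝ᵥ (A s *ᵥ (Y s *ᵥ w)) := by
        rw [mulVec_transpose, dotProduct_mulVec (X s *ᵥ w)]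
      rw [add_mulVec, add_mulVec, add_dotProduct, dotProduct_add, neg_mul, neg_mulVec,
        neg_dotProduct, ← mulVec_mulVec, ← mulVec_mulVec, ← mulVec_mulVec, ← mulVec_mulVec, h3,
        dotProduct_comm (S s *ᵥ _)]
      linarith)
  simp only [hX₀, hY₀, one_mulVec, hXw, zero_dotProduct] at hmono
  have := hP₀.dotProduct_mulVec_pos hw
  simp only [star_trivial] at this
  linarith

section
attribute [local instance] Matrix.linftyOpNormedAddCommGroup Matrix.linftyOpNormedRing
  Matrix.linftyOpNormedAlgebra

theorem hasDerivWithinAt_matrix_inv {X : ℝ → Matrix ι ι ℝ} {X' : Matrix ι ι ℝ} {s : Set ℝ}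
    {t : ℝ} (hX : HasDerivWithinAt X X' s t) (hu : IsUnit (X t)) :
    HasDerivWithinAt (fun r => (X r)⁻¹) (-((X t)⁻¹ * X' * (X t)⁻¹)) s t := by
  obtain ⟨U, hU⟩ := hu
  have h := hasFDerivAt_ringInverse (𝕜 := ℝ) U
  rw [hU] at h
  have := h.comp_hasDerivWithinAt t hX
  simp only [nonsing_inv_eq_ringInverse]
  simp only [Function.comp_def, _root_.neg_apply,
    ContinuousLinearMap.mulLeftRight_apply, ← Ring.inverse_unit, hU] at this
  exact this

theorem hasDerivWithinAt_matrix_mul {X Y : ℝ → Matrix ι ι ℝ} {X' Y' : Matrix ι ι ℝ} {s : Set ℝ}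
    {t : ℝ} (hX : HasDerivWithinAt X X' s t) (hY : HasDerivWithinAt Y Y' s t) :
    HasDerivWithinAt (fun r => X r * Y r) (X' * Y t + X t * Y') s t :=
  hX.mul hY

end

/-- Radon's linearization: `Y X⁻¹` solves the Riccati equation wherever `X` is invertible, and for
positive definite `P₀` and nonnegative weights that is the whole half-line. -/
theorem exists_isRiccatiSolution {A : ℝ → Matrix ι ι ℝ} {C : Matrix κ ι ℝ}
    {Q : ℝ → Matrix κ κ ℝ} {V : ℝ → Matrix ι ι ℝ} {P₀ : Matrix ι ι ℝ}
    (hA : ContinuousOn A (Ici 0)) (hQ : ContinuousOn Q (Ici 0)) (hV : ContinuousOn V (Ici 0))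
    (hQn : ∀ t, 0 ≤ t → ∀ v, 0 ≤ v ⬝ᵥ (Q t *ᵥ v)) (hVn : ∀ t, 0 ≤ t → ∀ v, 0 ≤ v ⬝ᵥ (V t *ᵥ v))
    (hP₀ : P₀.PosDef) : ∃ P, IsRiccatiSolution A C Q V P ∧ P 0 = P₀ := by
  have hS : ContinuousOn (fun t => Cᵀ * Q t * C) (Ici 0) := by
    rw [continuousOn_iff_continuous_domRestrict] at *
    exact (continuous_const.matrix_mul hQ).matrix_mul continuous_const
  obtain ⟨X, Y, hX₀, hY₀, hXY⟩ := exists_hamiltonian_solution hA hS hV P₀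
  have hSn : ∀ t, 0 ≤ t → ∀ v, 0 ≤ v ⬝ᵥ ((Cᵀ * Q t * C) *ᵥ v) := fun t ht v => by
    rw [← mulVec_mulVec, ← mulVec_mulVec, dotProduct_mulVec, vecMul_transpose]
    exact hQn t ht _
  have hu : ∀ t, 0 ≤ t → IsUnit (X t) := fun t ht => isUnit_of_hamiltonian hP₀ hSn hVn hX₀ hY₀
    (fun t ht => (hXY t ht).1) (fun t ht => (hXY t ht).2) ht
  refine ⟨fun t => Y t * (X t)⁻¹, fun t ht i j => ?_, by simp [hX₀, hY₀]⟩
  have h := hasDerivWithinAt_matrix_mul (hXY t ht).2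
    (hasDerivWithinAt_matrix_inv (hXY t ht).1 (hu t ht))
  have h' := hasDerivWithinAt_pi.1 (hasDerivWithinAt_pi.1 h i) j
  have hinv : X t * (X t)⁻¹ = 1 :=
    Matrix.mul_nonsing_inv _ ((Matrix.isUnit_iff_isUnit_det _).1 (hu t ht))
  have e : A t * (Y t * (X t)⁻¹) + Y t * (X t)⁻¹ * (A t)ᵀ
      - Y t * (X t)⁻¹ * Cᵀ * Q t * C * (Y t * (X t)⁻¹) + V t
      = (V t * X t + A t * Y t) * (X t)⁻¹
        + Y t * -((X t)⁻¹ * (-(A t)ᵀ * X t + Cᵀ * Q t * C * Y t) * (X t)⁻¹) := by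
    have e1 : V t * X t * (X t)⁻¹ = V t := by rw [Matrix.mul_assoc, hinv, Matrix.mul_one]
    have e2 : (X t)⁻¹ * (-(A t)ᵀ * X t) * (X t)⁻¹ = -((X t)⁻¹ * (A t)ᵀ) := by
      rw [Matrix.mul_assoc, Matrix.mul_assoc, hinv, Matrix.mul_one, Matrix.mul_neg]
    rw [Matrix.add_mul, e1, Matrix.mul_add, Matrix.add_mul, e2]
    simp only [Matrix.mul_assoc, neg_add, neg_neg, Matrix.mul_add, Matrix.mul_neg]
    abel
  beta_reduce
  rw [e]
  exact h'

end RiccatiExistence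

/-! ### The Hamiltonian pairing and its energy estimates. -/

/-- A Grönwall estimate in which the forcing term is dominated by the increase of a monotone
function. -/
theorem le_exp_mul_add_of_hasDerivWithinAt_le {h h' E E' : ℝ → ℝ} {κ c a b : ℝ} (ha : 0 ≤ a)
    (hab : a ≤ b) (hκ : 0 ≤ κ) (hc : 0 ≤ c)
    (hh : ∀ s ∈ Icc a b, HasDerivWithinAt h (h' s) (Ici 0) s)
    (hE : ∀ s ∈ Icc a b, HasDerivWithinAt E (E' s) (Ici 0) s)
    (hE' : ∀ s ∈ Icc a b, 0 ≤ E' s) (hle : ∀ s ∈ Icc a b, h' s ≤ κ * h s + c * E' s) :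
    h b ≤ Real.exp (κ * (b - a)) * (h a + c * (E b - E a)) := by
  have hexp : ∀ s, HasDerivWithinAt (fun s => Real.exp (-(κ * (s - a))))
      (Real.exp (-(κ * (s - a))) * (-κ)) (Ici 0) s := fun s => by
    have h1 : HasDerivWithinAt (fun s : ℝ => -(κ * (s - a))) (-κ) (Ici 0) s := by
      simpa using (((hasDerivWithinAt_id s (Ici 0)).sub_const a).const_mul κ).fun_neg
    exact h1.exp
  have key := le_of_hasDerivWithinAt_le ha hab
    (fun s hs => (hexp s).mul (hh s hs)) (fun s hs => (hE s hs).const_mul c) (fun s hs => by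
      have h1 : Real.exp (-(κ * (s - a))) ≤ 1 := Real.exp_le_one_iff.2 (by
        have := mul_nonneg hκ (sub_nonneg.2 hs.1); linarith)
      have h2 := mul_le_mul_of_nonneg_left (hle s hs) (Real.exp_pos (-(κ * (s - a)))).le
      have h3 := mul_le_mul_of_nonneg_right h1 (mul_nonneg hc (hE' s hs))
      nlinarith)
  simp only [Pi.mul_apply, sub_self, mul_zero, neg_zero, Real.exp_zero, one_mul] at key
  have h4 : Real.exp (κ * (b - a)) * Real.exp (-(κ * (b - a))) = 1 := by
    rw [← Real.exp_add]; simp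
  calc h b = Real.exp (κ * (b - a)) * (Real.exp (-(κ * (b - a))) * h b) := by
        rw [← mul_assoc, h4, one_mul]
    _ ≤ _ := by
        gcongr
        linarith

section Costate

variable {ι κ : Type*} [Fintype ι] [Fintype κ]

/-- Uniform bounds on the coefficients of a Riccati equation with `S = Cᵀ Q C`. -/
structure RiccatiBounds (A : ℝ → Matrix ι ι ℝ) (C : Matrix κ ι ℝ) (S V : ℝ → Matrix ι ι ℝ)
    (ε K : ℝ) : Prop where
  eps_pos : 0 < ε
  bound_pos : 0 < K
  state_le : ∀ t, 0 ≤ t → ∀ v, (A t *ᵥ v) ⬝ᵥ (A t *ᵥ v) ≤ K * (v ⬝ᵥ v)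
  stateT_le : ∀ t, 0 ≤ t → ∀ v, ((A t)ᵀ *ᵥ v) ⬝ᵥ ((A t)ᵀ *ᵥ v) ≤ K * (v ⬝ᵥ v)
  output_le : ∀ v, (C *ᵥ v) ⬝ᵥ (C *ᵥ v) ≤ K * (v ⬝ᵥ v)
  weight_symm : ∀ t, 0 ≤ t → (S t)ᵀ = S t
  le_weight : ∀ t, 0 ≤ t → ∀ v, ε * ((C *ᵥ v) ⬝ᵥ (C *ᵥ v)) ≤ v ⬝ᵥ (S t *ᵥ v)
  weight_le : ∀ t, 0 ≤ t → ∀ v, (S t *ᵥ v) ⬝ᵥ (S t *ᵥ v) ≤ K * ((C *ᵥ v) ⬝ᵥ (C *ᵥ v))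
  noise_symm : ∀ t, 0 ≤ t → (V t)ᵀ = V t
  le_noise : ∀ t, 0 ≤ t → ∀ v, ε * (v ⬝ᵥ v) ≤ v ⬝ᵥ (V t *ᵥ v)
  noise_le : ∀ t, 0 ≤ t → ∀ v, (V t *ᵥ v) ⬝ᵥ (V t *ᵥ v) ≤ K * (v ⬝ᵥ v)

/-- Solutions of the Hamiltonian system `ṗ = -Aᵀ p + S x`, `ẋ = A x + V p` on `[0, ∞)`. -/
structure IsHamiltonianPair (A S V : ℝ → Matrix ι ι ℝ) (p x : ℝ → ι → ℝ) : Prop where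
  costate : ∀ t, 0 ≤ t → HasDerivWithinAt p (-((A t)ᵀ *ᵥ p t) + S t *ᵥ x t) (Ici 0) t
  state : ∀ t, 0 ≤ t → HasDerivWithinAt x (A t *ᵥ x t + V t *ᵥ p t) (Ici 0) t

theorem IsHamiltonianPair.hasDerivWithinAt_pairing {A S V : ℝ → Matrix ι ι ℝ}
    {p x q y : ℝ → ι → ℝ} (h : IsHamiltonianPair A S V p x) (h' : IsHamiltonianPair A S V q y)
    {t : ℝ} (ht : 0 ≤ t) :
    HasDerivWithinAt (fun s => p s ⬝ᵥ y s)
      ((S t *ᵥ x t) ⬝ᵥ y t + p t ⬝ᵥ (V t *ᵥ q t)) (Ici 0) t := by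
  convert hasDerivWithinAt_dotProduct (h.costate t ht) (h'.state t ht) using 1
  have h3 : ((A t)ᵀ *ᵥ p t) ⬝ᵥ y t = p t ⬝ᵥ (A t *ᵥ y t) := by
    rw [mulVec_transpose, dotProduct_mulVec]
  rw [add_dotProduct, dotProduct_add, neg_dotProduct, h3]
  ring

theorem IsRiccatiSolution.continuousOn {A : ℝ → Matrix ι ι ℝ} {C : Matrix κ ι ℝ}
    {Q : ℝ → Matrix κ κ ℝ} {V P : ℝ → Matrix ι ι ℝ} (hP : IsRiccatiSolution A C Q V P) :
    ContinuousOn P (Ici 0) :=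
  continuousOn_pi.2 fun i => continuousOn_pi.2 fun j => fun t ht =>
    (hP t ht i j).continuousWithinAt

/-- Once `P` is known, the costate equation closes up as `ṗ = (-Aᵀ + S P) p`, and the Riccati
equation supplies the equation of `x = P p`. Since the value at `T` is arbitrary, every `v ⬝ᵥ P T v`
is the pairing at time `T` of such a solution. -/
theorem IsRiccatiSolution.exists_isHamiltonianPair {A : ℝ → Matrix ι ι ℝ} {C : Matrix κ ι ℝ}
    {Q : ℝ → Matrix κ κ ℝ} {V P : ℝ → Matrix ι ι ℝ} (hP : IsRiccatiSolution A C Q V P)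
    (hA : ContinuousOn A (Ici 0)) (hQ : ContinuousOn Q (Ici 0)) (T : ℝ) (v : ι → ℝ) :
    ∃ p : ℝ → ι → ℝ, p T = v ∧
      IsHamiltonianPair A (fun t => Cᵀ * Q t * C) V p (fun t => P t *ᵥ p t) := by
  have hM : ContinuousOn (fun t => -(A t)ᵀ + Cᵀ * Q t * C * P t) (Ici 0) := by
    have hPc := hP.continuousOn
    rw [continuousOn_iff_continuous_domRestrict] at *
    exact hA.matrix_transpose.neg.add (((continuous_const.matrix_mul hQ).matrix_mul
      continuous_const).matrix_mul hPc)
  obtain ⟨p, hpT, hp⟩ := exists_linear_solution hM (b := fun _ => 0) continuousOn_const T v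
  have hp' : ∀ t, 0 ≤ t → HasDerivWithinAt p
      (-((A t)ᵀ *ᵥ p t) + (Cᵀ * Q t * C) *ᵥ (P t *ᵥ p t)) (Ici 0) t := fun t ht => by
    have := hp t ht
    rwa [add_zero, add_mulVec, neg_mulVec, ← mulVec_mulVec] at this
  refine ⟨p, hpT, hp', fun t ht => ?_⟩
  convert hasDerivWithinAt_mulVec (hP t ht) (hp' t ht) using 1
  simp only [add_mulVec, sub_mulVec, mulVec_add, mulVec_neg, ← mulVec_mulVec]
  abel

/-- For two costates `p`, `q`, symmetry of `S` and `V` makes `p ⬝ᵥ P q - q ⬝ᵥ P p` a constant of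
motion, which vanishes at time `0`. -/
theorem IsRiccatiSolution.transpose_eq {A : ℝ → Matrix ι ι ℝ} {C : Matrix κ ι ℝ}
    {Q : ℝ → Matrix κ κ ℝ} {V P : ℝ → Matrix ι ι ℝ} (hP : IsRiccatiSolution A C Q V P)
    (hA : ContinuousOn A (Ici 0)) (hQ : ContinuousOn Q (Ici 0))
    (hQs : ∀ t, 0 ≤ t → (Q t)ᵀ = Q t) (hVs : ∀ t, 0 ≤ t → (V t)ᵀ = V t)
    (hP₀ : (P 0)ᵀ = P 0) {T : ℝ} (hT : 0 ≤ T) : (P T)ᵀ = P T := by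
  have swap : ∀ M : Matrix ι ι ℝ, Mᵀ = M → ∀ v w, v ⬝ᵥ (M *ᵥ w) = (M *ᵥ v) ⬝ᵥ w :=
    fun M hM v w => by rw [dotProduct_mulVec, ← mulVec_transpose, hM]
  have key : ∀ v w, v ⬝ᵥ (P T *ᵥ w) = w ⬝ᵥ (P T *ᵥ v) := by
    intro v w
    obtain ⟨p, rfl, hp⟩ := hP.exists_isHamiltonianPair hA hQ T v
    obtain ⟨q, rfl, hq⟩ := hP.exists_isHamiltonianPair hA hQ T w
    have hzero := eq_of_hasDerivWithinAt_zero le_rfl hT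
      (f := fun t => p t ⬝ᵥ (P t *ᵥ q t) - q t ⬝ᵥ (P t *ᵥ p t)) (fun t ht => by
        refine ((hp.hasDerivWithinAt_pairing hq ht.1).fun_sub
          (hq.hasDerivWithinAt_pairing hp ht.1)).congr_deriv ?_
        have h1 := swap _ (hVs t ht.1) (p t) (q t)
        have hS : (Cᵀ * Q t * C)ᵀ = Cᵀ * Q t * C := by
          simp [transpose_mul, hQs t ht.1, Matrix.mul_assoc]
        have h2 := swap _ hS (P t *ᵥ p t) (P t *ᵥ q t)
        rw [h1, ← h2, dotProduct_comm (P t *ᵥ p t), dotProduct_comm (V t *ᵥ p t)]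
        ring)
    have h0 := swap _ hP₀ (p 0) (q 0)
    rw [dotProduct_comm (P 0 *ᵥ p 0)] at h0
    linarith
  ext i j
  classical
  have := key (Pi.single i 1) (Pi.single j 1)
  simpa using this.symm

variable {A : ℝ → Matrix ι ι ℝ} {C : Matrix κ ι ℝ} {S V : ℝ → Matrix ι ι ℝ} {ε K : ℝ}
  {p x : ℝ → ι → ℝ}

theorem RiccatiBounds.le_power (hb : RiccatiBounds A C S V ε K) {t : ℝ} (ht : 0 ≤ t)
    (v w : ι → ℝ) : ε * ((C *ᵥ v) ⬝ᵥ (C *ᵥ v)) + ε * (w ⬝ᵥ w)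
      ≤ (S t *ᵥ v) ⬝ᵥ v + w ⬝ᵥ (V t *ᵥ w) := by
  rw [dotProduct_comm (S t *ᵥ v)]
  exact add_le_add (hb.le_weight t ht v) (hb.le_noise t ht w)

theorem RiccatiBounds.power_nonneg (hb : RiccatiBounds A C S V ε K) {t : ℝ} (ht : 0 ≤ t)
    (v w : ι → ℝ) : 0 ≤ (S t *ᵥ v) ⬝ᵥ v + w ⬝ᵥ (V t *ᵥ w) :=
  (add_nonneg (mul_nonneg hb.eps_pos.le (dotProduct_self_nonneg _))
    (mul_nonneg hb.eps_pos.le (dotProduct_self_nonneg _))).trans (hb.le_power ht v w)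

theorem IsHamiltonianPair.pairing_mono (hb : RiccatiBounds A C S V ε K)
    (h : IsHamiltonianPair A S V p x) {a b : ℝ} (ha : 0 ≤ a) (hab : a ≤ b) :
    p a ⬝ᵥ x a ≤ p b ⬝ᵥ x b :=
  le_of_hasDerivWithinAt_nonneg ha hab
    (fun _ ht => h.hasDerivWithinAt_pairing h (ha.trans ht.1))
    fun _ ht => hb.power_nonneg (ha.trans ht.1) _ _

/-- The forcing `S x` of the costate is paid for by the pairing: its square is at most `K` times
that of `C x`, which is at most `1 / ε` times the derivative of `p ⬝ᵥ x`. -/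
theorem IsHamiltonianPair.costate_le (hb : RiccatiBounds A C S V ε K)
    (h : IsHamiltonianPair A S V p x) {a b : ℝ} (ha : 0 ≤ a) (hab : a ≤ b) :
    p b ⬝ᵥ p b ≤ Real.exp ((2 + K) * (b - a)) *
      (p a ⬝ᵥ p a + K / ε * (p b ⬝ᵥ x b - p a ⬝ᵥ x a)) := by
  have hK := hb.bound_pos
  have hε := hb.eps_pos
  refine le_exp_mul_add_of_hasDerivWithinAt_le ha hab (by linarith) (by positivity)
    (fun t ht => hasDerivWithinAt_dotProduct (h.costate t (ha.trans ht.1))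
      (h.costate t (ha.trans ht.1)))
    (fun t ht => h.hasDerivWithinAt_pairing h (ha.trans ht.1))
    (fun t ht => hb.power_nonneg (ha.trans ht.1) _ _) fun t ht => ?_
  have ht0 := ha.trans ht.1
  have h1 := neg_two_mul_dotProduct_le (p t) ((A t)ᵀ *ᵥ p t)
  have h2 := two_mul_dotProduct_le (p t) (S t *ᵥ x t)
  have h3 := hb.stateT_le t ht0 (p t)
  have h4 := hb.weight_le t ht0 (x t)
  have h5 := hb.le_power ht0 (x t) (p t)
  have h6 := mul_nonneg hε.le (dotProduct_self_nonneg (p t))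
  have h7 : K * ((C *ᵥ x t) ⬝ᵥ (C *ᵥ x t)) ≤
      K / ε * ((S t *ᵥ x t) ⬝ᵥ x t + p t ⬝ᵥ (V t *ᵥ p t)) := by
    rw [div_mul_eq_mul_div, le_div_iff₀ hε, mul_assoc]
    exact mul_le_mul_of_nonneg_left (by linarith) hK.le
  rw [add_dotProduct, dotProduct_add, neg_dotProduct, dotProduct_neg,
    dotProduct_comm ((A t)ᵀ *ᵥ p t), dotProduct_comm (S t *ᵥ x t) (p t)]
  linarith

/-- Uniform observability on a sliding window: along solutions of `ẋ = A x`, the energy of the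
output `C x` over a window controls the state at the beginning of the window. -/
def UniformlyObservable (A : ℝ → Matrix ι ι ℝ) (C : Matrix κ ι ℝ) : Prop :=
  ∃ Λ > 0, ∃ K > 0, ∀ t, 0 ≤ t → ∀ x : ℝ → ι → ℝ,
    (∀ s, 0 ≤ s → HasDerivWithinAt x (A s *ᵥ x s) (Ici 0) s) →
    ∀ J J' : ℝ → ℝ, (∀ s, 0 ≤ s → HasDerivWithinAt J (J' s) (Ici 0) s) →
      (∀ s ∈ Icc t (t + Λ), (C *ᵥ x s) ⬝ᵥ (C *ᵥ x s) ≤ J' s) →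
      x t ⬝ᵥ x t ≤ K * (J (t + Λ) - J t)

theorem RiccatiBounds.state_growth (hb : RiccatiBounds A C S V ε K) {y d : ℝ → ι → ℝ}
    {E E' : ℝ → ℝ} {c a b : ℝ} (ha : 0 ≤ a) (hab : a ≤ b) (hc : 0 ≤ c)
    (hy : ∀ s ∈ Icc a b, HasDerivWithinAt y (A s *ᵥ y s + d s) (Ici 0) s)
    (hE : ∀ s ∈ Icc a b, HasDerivWithinAt E (E' s) (Ici 0) s)
    (hE' : ∀ s ∈ Icc a b, 0 ≤ E' s) (hd : ∀ s ∈ Icc a b, d s ⬝ᵥ d s ≤ c * E' s) :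
    y b ⬝ᵥ y b ≤ Real.exp ((2 + K) * (b - a)) * (y a ⬝ᵥ y a + c * (E b - E a)) := by
  refine le_exp_mul_add_of_hasDerivWithinAt_le ha hab (by linarith [hb.bound_pos]) hc
    (fun t ht => hasDerivWithinAt_dotProduct (hy t ht) (hy t ht)) hE hE' fun t ht => ?_
  have h1 := two_mul_dotProduct_le (y t) (A t *ᵥ y t)
  have h2 := two_mul_dotProduct_le (y t) (d t)
  have h3 := hb.state_le t (ha.trans ht.1) (y t)
  have h4 := hd t ht
  rw [add_dotProduct, dotProduct_add, dotProduct_comm (A t *ᵥ y t), dotProduct_comm (d t) (y t)]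
  linarith

/-- On `[T - Λ, T]` compare `x` with the free motion `y` that shares its initial value. The
difference is driven by `V p`, whose energy is controlled by the increase `Δ` of the pairing, so the
output energy of `y` is also `O(Δ)`. Observability bounds `y` at the start of the window, hence `x
T`, by `Δ`, and `Δ` is at most the final pairing because the pairing starts nonnegative and
increases. -/
theorem RiccatiBounds.exists_state_le_pairing (hb : RiccatiBounds A C S V ε K)
    (hA : ContinuousOn A (Ici 0)) (hobs : UniformlyObservable A C) :
    ∃ Λ > 0, ∃ M > 0, ∀ p x, IsHamiltonianPair A S V p x → 0 ≤ p 0 ⬝ᵥ x 0 →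
      ∀ T, Λ ≤ T → x T ⬝ᵥ x T ≤ M * (p T ⬝ᵥ x T) := by
  obtain ⟨Λ, hΛ, Ko, hKo, hobs⟩ := hobs
  have hK := hb.bound_pos
  have hε := hb.eps_pos
  set G := Real.exp ((2 + K) * Λ) with hG
  have hGpos : 0 < G := Real.exp_pos _
  set c := G * (K / ε) with hc
  have hcpos : 0 < c := by positivity
  refine ⟨Λ, hΛ, 2 * (G * (Ko * (2 / ε + 2 * K * c * Λ))) + 2 * c, by positivity,
    fun p x h h0 T hT => ?_⟩
  set t := T - Λ with ht
  have ht0 : 0 ≤ t := by linarith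
  have htT : T = t + Λ := by linarith
  obtain ⟨y, hyt, hy⟩ := exists_linear_solution hA (b := fun _ => 0) continuousOn_const t (x t)
  simp only [add_zero] at hy
  set E : ℝ → ℝ := fun s => p s ⬝ᵥ x s with hE
  have hEd := fun s hs => h.hasDerivWithinAt_pairing h (t := s) hs
  set Δ := E T - E t with hΔ
  have hΔ0 : 0 ≤ Δ := sub_nonneg.2 (h.pairing_mono hb ht0 (by linarith))
  have he : ∀ s ∈ Icc t T, (x s - y s) ⬝ᵥ (x s - y s) ≤ c * Δ := by
    intro s hs
    have hmem : ∀ r ∈ Icc t s, 0 ≤ r := fun r hr => ht0.trans hr.1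
    have := hb.state_growth (y := fun s => x s - y s) (d := fun s => V s *ᵥ p s) (E := E)
      (c := K / ε) ht0 hs.1 (by positivity)
      (fun r hr => by
        refine ((h.state r (hmem r hr)).fun_sub (hy r (hmem r hr))).congr_deriv ?_
        rw [mulVec_sub]; abel)
      (fun r hr => hEd r (hmem r hr)) (fun r hr => hb.power_nonneg (hmem r hr) _ _)
      (fun r hr => by
        have h1 := hb.noise_le r (hmem r hr) (p r)
        have h2 := hb.le_power (hmem r hr) (x r) (p r)
        have h3 := mul_nonneg hε.le (dotProduct_self_nonneg (C *ᵥ x r))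
        refine h1.trans ?_
        rw [div_mul_eq_mul_div, le_div_iff₀ hε, mul_assoc]
        exact mul_le_mul_of_nonneg_left (by linarith) hK.le)
    simp only [hyt, sub_self, dotProduct_zero, zero_add] at this
    refine this.trans ?_
    rw [hc, mul_assoc]
    have h5 : E s ≤ E T := h.pairing_mono hb (ht0.trans hs.1) hs.2
    have h6 : 0 ≤ E s - E t := sub_nonneg.2 (h.pairing_mono hb ht0 hs.1)
    refine mul_le_mul ?_ ?_ (by positivity) hGpos.le
    · exact Real.exp_le_exp.2 (mul_le_mul_of_nonneg_left (by linarith [hs.2]) (by linarith))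
    · exact mul_le_mul_of_nonneg_left (by linarith) (by positivity)
  -- This `J` is a primitive of the bound for `|C y|² ≤ 2 |C x|² + 2 |C (x - y)|²`: the pairing
  -- dominates the first term, a constant the second.
  have hJ := hobs t ht0 y hy (fun s => 2 / ε * E s + 2 * K * c * Δ * s)
    (fun s => 2 / ε * ((S s *ᵥ x s) ⬝ᵥ x s + p s ⬝ᵥ (V s *ᵥ p s)) + 2 * K * c * Δ)
    (fun s hs => by
      simpa using ((hEd s hs).const_mul (2 / ε)).fun_add
        ((hasDerivWithinAt_id s (Ici 0)).const_mul (2 * K * c * Δ)))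
    (fun s hs => by
      have hs0 := ht0.trans hs.1
      have h1 := dotProduct_self_sub_le (C *ᵥ x s) (C *ᵥ (x s - y s))
      rw [← mulVec_sub, sub_sub_cancel] at h1
      have h2 := hb.output_le (x s - y s)
      have h3 := mul_le_mul_of_nonneg_left (he s ⟨hs.1, by linarith [hs.2]⟩) hK.le
      have h4 := hb.le_power hs0 (x s) (p s)
      have h5 := mul_nonneg hε.le (dotProduct_self_nonneg (p s))
      have h6 : 2 * ((C *ᵥ x s) ⬝ᵥ (C *ᵥ x s)) ≤
          2 / ε * ((S s *ᵥ x s) ⬝ᵥ x s + p s ⬝ᵥ (V s *ᵥ p s)) := by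
        rw [div_mul_eq_mul_div, le_div_iff₀ hε]
        linarith
      linarith)
  rw [← htT] at hJ
  have hyT := hb.state_growth (y := y) (d := fun _ => 0) (E := fun _ => 0) (E' := fun _ => 0)
    (c := 0) ht0 (by linarith : t ≤ T) le_rfl (fun r hr => by
      simpa using hy r (ht0.trans hr.1)) (fun r _ => hasDerivWithinAt_const _ _ _)
    (fun _ _ => le_rfl) (fun _ _ => by simp)
  rw [show T - t = Λ by linarith, ← hG, zero_mul, add_zero] at hyT
  have hxT := dotProduct_self_add_le (y T) (x T - y T)
  rw [add_sub_cancel] at hxT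
  have heT := he T ⟨by linarith, le_rfl⟩
  have hE0 : Δ ≤ E T := by
    have : E 0 ≤ E t := h.pairing_mono hb le_rfl ht0
    have h0' : 0 ≤ E 0 := h0
    linarith
  have hfin : x T ⬝ᵥ x T ≤ (2 * (G * (Ko * (2 / ε + 2 * K * c * Λ))) + 2 * c) * Δ := by
    have h1 := mul_le_mul_of_nonneg_left hJ hGpos.le
    have h2 : Ko * (2 / ε * E T + 2 * K * c * Δ * T - (2 / ε * E t + 2 * K * c * Δ * t))
        = Ko * (2 / ε + 2 * K * c * Λ) * Δ := by
      rw [hΔ, htT]; ring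
    rw [h2] at h1
    linarith
  exact hfin.trans (mul_le_mul_of_nonneg_left hE0 (by positivity))

end Costate

/-! ### Uniform bounds on `P` and exponential decay. -/

theorem exists_pos_mul_dotProduct_self_le {ι : Type*} [Fintype ι] {P : Matrix ι ι ℝ}
    (hP : P.PosDef) : ∃ c > 0, ∀ v, c * (v ⬝ᵥ v) ≤ v ⬝ᵥ (P *ᵥ v) := by
  have hcont : Continuous fun v : ι → ℝ => v ⬝ᵥ (P *ᵥ v) :=
    continuous_id.dotProduct (continuous_const.matrix_mulVec continuous_id)
  have hcont' : Continuous fun v : ι → ℝ => v ⬝ᵥ v := continuous_id.dotProduct continuous_id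
  have hle : ∀ (v : ι → ℝ) i, v i ^ 2 ≤ v ⬝ᵥ v := fun v i => by
    rw [pow_two]
    exact Finset.single_le_sum (f := fun i => v i * v i) (fun i _ => mul_self_nonneg (v i))
      (Finset.mem_univ i)
  have hcomp : IsCompact {v : ι → ℝ | v ⬝ᵥ v = 1} := by
    refine (isCompact_univ_pi fun _ : ι => isCompact_Icc (a := (-1 : ℝ)) (b := 1)).of_isClosed_subset
      (isClosed_eq hcont' continuous_const) fun v hv i _ => ?_
    have h1 := hle v i
    rw [show v ⬝ᵥ v = 1 from hv] at h1
    exact abs_le.1 ((sq_le_one_iff_abs_le_one _).1 h1)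
  have hpos : ∀ v : ι → ℝ, v ≠ 0 → 0 < v ⬝ᵥ (P *ᵥ v) := fun v hv => by
    simpa using hP.dotProduct_mulVec_pos hv
  rcases ({v : ι → ℝ | v ⬝ᵥ v = 1}).eq_empty_or_nonempty with he | hne
  · refine ⟨1, one_pos, fun v => ?_⟩
    have : v = 0 := by
      by_contra hv
      have h1 : 0 < v ⬝ᵥ v := lt_of_le_of_ne (dotProduct_self_nonneg v)
        fun h => hv (dotProduct_self_eq_zero.1 h.symm)
      have : (Real.sqrt (v ⬝ᵥ v))⁻¹ • v ∈ {v : ι → ℝ | v ⬝ᵥ v = 1} := by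
        simp only [mem_ofPred_eq, smul_dotProduct, dotProduct_smul, smul_eq_mul]
        rw [← mul_assoc, ← mul_inv, Real.mul_self_sqrt h1.le, inv_mul_cancel₀ h1.ne']
      rw [he] at this
      exact this
    simp [this]
  · obtain ⟨w, hw, hmin⟩ := hcomp.exists_isMinOn hne hcont.continuousOn
    have hw0 : w ≠ 0 := fun h => by simp [h] at hw
    refine ⟨_, hpos w hw0, fun v => ?_⟩
    by_cases hv : v = 0
    · simp [hv]
    have h1 : 0 < v ⬝ᵥ v := lt_of_le_of_ne (dotProduct_self_nonneg v)
      fun h => hv (dotProduct_self_eq_zero.1 h.symm)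
    have hmem : (Real.sqrt (v ⬝ᵥ v))⁻¹ • v ∈ {v : ι → ℝ | v ⬝ᵥ v = 1} := by
      simp only [mem_ofPred_eq, smul_dotProduct, dotProduct_smul, smul_eq_mul]
      rw [← mul_assoc, ← mul_inv, Real.mul_self_sqrt h1.le, inv_mul_cancel₀ h1.ne']
    have h2 := hmin hmem
    simp only [mem_ofPred_eq, smul_dotProduct, dotProduct_smul, mulVec_smul, smul_eq_mul] at h2
    rw [← mul_assoc, ← mul_inv, Real.mul_self_sqrt h1.le, inv_mul_eq_div, le_div_iff₀ h1] at h2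
    exact h2

section RiccatiStability

variable {ι κ : Type*} [Fintype ι] [Fintype κ] {A : ℝ → Matrix ι ι ℝ} {C : Matrix κ ι ℝ}
  {Q : ℝ → Matrix κ κ ℝ} {V P : ℝ → Matrix ι ι ℝ} {ε K : ℝ}

/-- During the last unit of time the pairing rises by at most its final value, so at some instant `ε
|p|²` is at most that value; before time `1` positivity of `P 0` plays this role. `costate_le`
carries the estimate to time `T`, with growth factor at most `G`. -/
theorem IsRiccatiSolution.exists_lower_bound (hP : IsRiccatiSolution A C Q V P)
    (hA : ContinuousOn A (Ici 0)) (hQ : ContinuousOn Q (Ici 0))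
    (hb : RiccatiBounds A C (fun t => Cᵀ * Q t * C) V ε K) (hP₀ : (P 0).PosDef) :
    ∃ m > 0, ∀ t, 0 ≤ t → ∀ v, m * (v ⬝ᵥ v) ≤ v ⬝ᵥ (P t *ᵥ v) := by
  obtain ⟨c, hc, hc'⟩ := exists_pos_mul_dotProduct_self_le hP₀
  have hK := hb.bound_pos
  have hε := hb.eps_pos
  set G := Real.exp (2 + K) with hG
  have hGpos : 0 < G := Real.exp_pos _
  set m := (G * (1 / c + 1 / ε + K / ε))⁻¹ with hm
  have hmpos : 0 < m := by positivity
  refine ⟨m, hmpos, fun T hT v => ?_⟩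
  obtain ⟨p, rfl, hp⟩ := hP.exists_isHamiltonianPair hA hQ T v
  set E : ℝ → ℝ := fun s => p s ⬝ᵥ (P s *ᵥ p s) with hE
  have hmono : ∀ a b, 0 ≤ a → a ≤ b → E a ≤ E b := fun a b ha hab =>
    hp.pairing_mono hb ha hab
  have hE0 : 0 ≤ E 0 := (mul_nonneg hc.le (dotProduct_self_nonneg _)).trans (hc' (p 0))
  have hstart : ∃ a, 0 ≤ a ∧ a ≤ T ∧ T - a ≤ 1 ∧ p a ⬝ᵥ p a ≤ (1 / c + 1 / ε) * E T := by
    rcases le_total T 1 with h1 | h1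
    · refine ⟨0, le_rfl, hT, by linarith, ?_⟩
      have h2 : p 0 ⬝ᵥ p 0 ≤ 1 / c * E 0 := by
        rw [one_div, ← div_eq_inv_mul, le_div_iff₀ hc, mul_comm]
        exact hc' (p 0)
      have h3 := mul_le_mul_of_nonneg_left (hmono 0 T le_rfl hT) (by positivity : 0 ≤ 1 / c)
      have h4 : 0 ≤ 1 / ε * E T := mul_nonneg (by positivity) (hE0.trans (hmono 0 T le_rfl hT))
      linarith
    · obtain ⟨a, ha, hslope⟩ := exists_hasDerivWithinAt_eq_slope (by linarith : 0 ≤ T - 1)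
        (by linarith : T - 1 < T)
        (fun s hs => hp.hasDerivWithinAt_pairing hp (by linarith [hs.1] : 0 ≤ s))
      have ha0 : 0 ≤ a := by linarith [ha.1]
      refine ⟨a, ha0, ha.2.le, by linarith [ha.1], ?_⟩
      rw [sub_sub_cancel, div_one] at hslope
      have h2 := hb.le_power ha0 (P a *ᵥ p a) (p a)
      rw [hslope] at h2
      have h3 := mul_nonneg hε.le (dotProduct_self_nonneg (C *ᵥ P a *ᵥ p a))
      have h5 : 0 ≤ E (T - 1) := hE0.trans (hmono 0 _ le_rfl (by linarith))
      have h6 : p a ⬝ᵥ p a ≤ 1 / ε * E T := by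
        rw [one_div, ← div_eq_inv_mul, le_div_iff₀ hε, mul_comm]
        simp only [hE] at h5 ⊢
        linarith
      have h4 : 0 ≤ 1 / c * E T := mul_nonneg (by positivity) (hE0.trans (hmono 0 T le_rfl hT))
      linarith
  obtain ⟨a, ha0, haT, ha1, ha⟩ := hstart
  have h1 := hp.costate_le hb ha0 haT
  have hET : 0 ≤ E T := hE0.trans (hmono 0 T le_rfl hT)
  have hEa : 0 ≤ E a := hE0.trans (hmono 0 a le_rfl ha0)
  have h2 : p T ⬝ᵥ p T ≤ G * (1 / c + 1 / ε + K / ε) * E T := by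
    refine h1.trans ?_
    rw [mul_assoc]
    refine mul_le_mul ?_ ?_ ?_ hGpos.le
    · exact Real.exp_le_exp.2 (by nlinarith)
    · have : K / ε * (E T - E a) ≤ K / ε * E T :=
        mul_le_mul_of_nonneg_left (by linarith) (by positivity)
      simp only [hE] at this ha ⊢
      linarith
    · exact add_nonneg (dotProduct_self_nonneg _) (mul_nonneg (by positivity)
        (sub_nonneg.2 (hmono a T ha0 haT)))
  rw [hm, ← div_eq_inv_mul, div_le_iff₀ (by positivity), mul_comm]
  exact h2

/-- After one observability window `|P v|² ≤ M (v ⬝ᵥ P v)`, whence `|P v|² ≤ M² |v|²`; earlier times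
are covered by compactness. -/
theorem IsRiccatiSolution.exists_upper_bound (hP : IsRiccatiSolution A C Q V P)
    (hA : ContinuousOn A (Ici 0)) (hQ : ContinuousOn Q (Ici 0))
    (hb : RiccatiBounds A C (fun t => Cᵀ * Q t * C) V ε K) (hobs : UniformlyObservable A C)
    (hP₀ : (P 0).PosSemidef) :
    ∃ M > 0, ∀ t, 0 ≤ t → ∀ v, v ⬝ᵥ (P t *ᵥ v) ≤ M * (v ⬝ᵥ v) := by
  obtain ⟨Λ, hΛ, M, hM, hlarge⟩ := hb.exists_state_le_pairing hA hobs
  obtain ⟨K', hK', hsmall⟩ := exists_dotProduct_self_mulVec_le_of_bounded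
    (exists_bound_of_continuousOn_matrix (isCompact_Icc (a := 0) (b := Λ))
      (hP.continuousOn.mono fun s hs => hs.1))
  have key : ∀ t, 0 ≤ t → ∀ v, (P t *ᵥ v) ⬝ᵥ (P t *ᵥ v) ≤ (K' + M ^ 2) * (v ⬝ᵥ v) := by
    intro t ht v
    have hv := dotProduct_self_nonneg v
    rcases le_total t Λ with h | h
    · have := hsmall t ⟨ht, h⟩ v
      nlinarith [mul_nonneg (sq_nonneg M) hv]
    · obtain ⟨p, rfl, hp⟩ := hP.exists_isHamiltonianPair hA hQ t v
      have h1 := hlarge _ _ hp (by simpa using hP₀.dotProduct_mulVec_nonneg (p 0)) t h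
      have h2 := two_mul_dotProduct_le (M • p t) (P t *ᵥ p t)
      simp only [smul_dotProduct, dotProduct_smul, smul_eq_mul] at h2
      have h3 := mul_nonneg hK'.le hv
      linarith
  refine ⟨1 + (K' + M ^ 2), by positivity, fun t ht v => ?_⟩
  have h1 := two_mul_dotProduct_le v (P t *ᵥ v)
  have h2 := key t ht v
  have h3 := dotProduct_self_nonneg v
  have h4 := dotProduct_self_nonneg (P t *ᵥ v)
  linarith

/-- Duality avoids differentiating the inverse of `P`. Let `ζ` solve the adjoint of the error
equation with final value `e t`. Then `ζ ⬝ᵥ e` is constant, so `|e t|² = ζ t₀ ⬝ᵥ e t₀`, while `ζ ⬝ᵥ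
P ζ` grows at rate at least `ε / M`. Thus `|ζ t₀|²` is exponentially small relative to `|e t|²`, and
Cauchy–Schwarz concludes. -/
theorem IsRiccatiSolution.exists_exp_bound (hP : IsRiccatiSolution A C Q V P)
    (hA : ContinuousOn A (Ici 0)) (hQ : ContinuousOn Q (Ici 0))
    (hQs : ∀ t, 0 ≤ t → (Q t)ᵀ = Q t)
    (hb : RiccatiBounds A C (fun t => Cᵀ * Q t * C) V ε K) (hobs : UniformlyObservable A C)
    (hP₀ : (P 0).PosDef) {k : ℝ → ℝ} (hkc : ContinuousOn k (Ici 0))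
    (hk : ∀ t, 0 ≤ t → 1 / 2 ≤ k t) :
    ∃ c > 0, ∃ r > 0, ∀ e : ℝ → ι → ℝ,
      (∀ t, 0 ≤ t → HasDerivWithinAt e
        (A t *ᵥ e t - k t • (P t *ᵥ ((Cᵀ * Q t * C) *ᵥ e t))) (Ici 0) t) →
      ∀ t₀ t, 0 ≤ t₀ → t₀ ≤ t →
        e t ⬝ᵥ e t ≤ c * Real.exp (-r * (t - t₀)) * (e t₀ ⬝ᵥ e t₀) := by
  obtain ⟨m, hm, hlow⟩ := hP.exists_lower_bound hA hQ hb hP₀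
  obtain ⟨M, hM, hup⟩ := hP.exists_upper_bound hA hQ hb hobs hP₀.posSemidef
  have hε := hb.eps_pos
  have hPs : ∀ t, 0 ≤ t → (P t)ᵀ = P t := fun t ht =>
    hP.transpose_eq hA hQ hQs hb.noise_symm (by simpa using hP₀.isHermitian.eq) ht
  have swap : ∀ M : Matrix ι ι ℝ, Mᵀ = M → ∀ v w, v ⬝ᵥ (M *ᵥ w) = (M *ᵥ v) ⬝ᵥ w :=
    fun M hM v w => by rw [dotProduct_mulVec, ← mulVec_transpose, hM]
  refine ⟨M / m, by positivity, ε / M, by positivity, fun e he t₀ t ht₀ htt => ?_⟩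
  set S : ℝ → Matrix ι ι ℝ := fun t => Cᵀ * Q t * C with hS
  have hcoef : ContinuousOn (fun t => -(A t)ᵀ + k t • (S t * P t)) (Ici 0) := by
    have hPc := hP.continuousOn
    rw [continuousOn_iff_continuous_domRestrict] at *
    exact hA.matrix_transpose.neg.add (hkc.smul (((continuous_const.matrix_mul hQ).matrix_mul
      continuous_const).matrix_mul hPc))
  obtain ⟨ζ, hζt, hζ'⟩ := exists_linear_solution hcoef (b := fun _ => 0) continuousOn_const t (e t)
  have hζ : ∀ s, 0 ≤ s → HasDerivWithinAt ζ
      (-((A s)ᵀ *ᵥ ζ s) + k s • (S s *ᵥ (P s *ᵥ ζ s))) (Ici 0) s := fun s hs => by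
    have := hζ' s hs
    rwa [add_zero, add_mulVec, neg_mulVec, smul_mulVec, ← mulVec_mulVec] at this
  have hAT : ∀ s v w, ((A s)ᵀ *ᵥ v) ⬝ᵥ w = v ⬝ᵥ (A s *ᵥ w) := fun s v w => by
    rw [mulVec_transpose, dotProduct_mulVec]
  have hpair : ζ t₀ ⬝ᵥ e t₀ = ζ t ⬝ᵥ e t := by
    refine eq_of_hasDerivWithinAt_zero (f := fun s => ζ s ⬝ᵥ e s) ht₀ htt fun s hs => ?_
    have hs0 := ht₀.trans hs.1
    refine (hasDerivWithinAt_dotProduct (hζ s hs0) (he s hs0)).congr_deriv ?_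
    rw [add_dotProduct, neg_dotProduct, dotProduct_sub, hAT, smul_dotProduct, dotProduct_smul,
      ← swap _ (hb.weight_symm s hs0), swap _ (hPs s hs0)]
    ring
  have hW : ∀ s ∈ Icc t₀ t, HasDerivWithinAt (fun s => ζ s ⬝ᵥ (P s *ᵥ ζ s))
      ((2 * k s - 1) * ((P s *ᵥ ζ s) ⬝ᵥ (S s *ᵥ (P s *ᵥ ζ s))) + ζ s ⬝ᵥ (V s *ᵥ ζ s))
      (Ici 0) s := fun s hs => by
    have hs0 := ht₀.trans hs.1
    refine (hasDerivWithinAt_dotProduct (hζ s hs0)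
      (hasDerivWithinAt_mulVec (hP s hs0) (hζ s hs0))).congr_deriv ?_
    have h1 : (S s *ᵥ (P s *ᵥ ζ s)) ⬝ᵥ (P s *ᵥ ζ s)
      = (P s *ᵥ ζ s) ⬝ᵥ (S s *ᵥ (P s *ᵥ ζ s)) := dotProduct_comm _ _
    have h2 : ζ s ⬝ᵥ (P s *ᵥ (S s *ᵥ (P s *ᵥ ζ s)))
      = (P s *ᵥ ζ s) ⬝ᵥ (S s *ᵥ (P s *ᵥ ζ s)) := swap _ (hPs s hs0) _ _
    have h3 : (P s * Cᵀ * Q s * C * P s) = P s * (S s * P s) := by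
      simp only [hS, Matrix.mul_assoc]
    rw [h3]
    simp only [add_mulVec, sub_mulVec, mulVec_add, mulVec_neg, mulVec_smul, ← mulVec_mulVec,
      add_dotProduct, dotProduct_add, dotProduct_sub, dotProduct_neg, neg_dotProduct,
      smul_dotProduct, dotProduct_smul, hAT, h1, h2, smul_eq_mul]
    ring
  set r := ε / M with hr
  have hexp : ∀ s, HasDerivWithinAt (fun s => Real.exp (-r * (s - t₀)))
      (Real.exp (-r * (s - t₀)) * (-r)) (Ici 0) s := fun s => by
    have h1 : HasDerivWithinAt (fun s : ℝ => -r * (s - t₀)) (-r) (Ici 0) s := by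
      simpa using ((hasDerivWithinAt_id s (Ici 0)).sub_const t₀).const_mul (-r)
    exact h1.exp
  have hgrow : ζ t₀ ⬝ᵥ (P t₀ *ᵥ ζ t₀) ≤ Real.exp (-r * (t - t₀)) * (ζ t ⬝ᵥ (P t *ᵥ ζ t)) := by
    have := le_of_hasDerivWithinAt_nonneg ht₀ htt (fun s hs => (hexp s).mul (hW s hs))
      (fun s hs => by
        have hs0 := ht₀.trans hs.1
        have h1 := hb.le_noise s hs0 (ζ s)
        have h2 : 0 ≤ (P s *ᵥ ζ s) ⬝ᵥ (S s *ᵥ (P s *ᵥ ζ s)) :=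
          (mul_nonneg hε.le (dotProduct_self_nonneg _)).trans (hb.le_weight s hs0 _)
        -- The condition `1 / 2 ≤ k` makes the output term contribute to the growth with the right
        -- sign.
        have h3 := mul_nonneg (by linarith [hk s hs0] : 0 ≤ 2 * k s - 1) h2
        have h4 : r * (ζ s ⬝ᵥ (P s *ᵥ ζ s)) ≤ ε * (ζ s ⬝ᵥ ζ s) := by
          rw [hr, div_mul_eq_mul_div, div_le_iff₀ hM, mul_assoc]
          refine mul_le_mul_of_nonneg_left ?_ hε.le
          rw [mul_comm]
          exact hup s hs0 _
        have h5 := mul_nonneg (Real.exp_pos (-r * (s - t₀))).le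
          (by linarith : 0 ≤ (2 * k s - 1) * ((P s *ᵥ ζ s) ⬝ᵥ (S s *ᵥ (P s *ᵥ ζ s)))
            + ζ s ⬝ᵥ (V s *ᵥ ζ s) - r * (ζ s ⬝ᵥ (P s *ᵥ ζ s)))
        linarith)
    simpa using this
  have hζ0 : ζ t₀ ⬝ᵥ ζ t₀ ≤ M / m * Real.exp (-r * (t - t₀)) * (e t ⬝ᵥ e t) := by
    have h1 := hlow t₀ ht₀ (ζ t₀)
    have h2 := mul_le_mul_of_nonneg_left (hup t (ht₀.trans htt) (ζ t))
      (Real.exp_pos (-r * (t - t₀))).le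
    rw [← hζt, div_mul_eq_mul_div, div_mul_eq_mul_div, le_div_iff₀ hm]
    linarith
  rcases (dotProduct_self_nonneg (e t)).eq_or_lt with h0 | h0
  · rw [← h0]
    have := dotProduct_self_nonneg (e t₀)
    positivity
  · have h1 := dotProduct_sq_le (ζ t₀) (e t₀)
    rw [hpair, hζt] at h1
    have h2 := mul_le_mul_of_nonneg_right hζ0 (dotProduct_self_nonneg (e t₀))
    refine le_of_mul_le_mul_right ?_ h0
    linarith

end RiccatiStability

/-! ### Interpolation inequalities. -/

theorem abs_sub_le_of_abs_deriv_le {g g' : ℝ → ℝ} {a b L : ℝ} (ha : 0 ≤ a) (hab : a ≤ b)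
    (hg : ∀ s ∈ Icc a b, HasDerivWithinAt g (g' s) (Ici 0) s)
    (hL : ∀ s ∈ Icc a b, |g' s| ≤ L) : |g b - g a| ≤ L * (b - a) := by
  have hlin : ∀ (c : ℝ), ∀ s ∈ Icc a b, HasDerivWithinAt (fun s => c * s) c (Ici 0) s :=
    fun c s _ => by simpa using (hasDerivWithinAt_id s (Ici 0)).const_mul c
  have h1 := le_of_hasDerivWithinAt_le ha hab hg (hlin L) fun s hs => (abs_le.1 (hL s hs)).2
  have h2 := le_of_hasDerivWithinAt_le ha hab (hlin (-L)) hg fun s hs => (abs_le.1 (hL s hs)).1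
  rw [abs_le]
  constructor <;> linarith

/-- Landau's argument: at some point of the window `g'` equals a difference quotient, at most `2 * ε
/ h`, and on the way back to `s` it changes by at most `L * h`. -/
theorem abs_deriv_le_of_abs_le {g g' g'' : ℝ → ℝ} {s h ε L : ℝ} (hs : 0 ≤ s) (hh : 0 < h)
    (hg : ∀ r ∈ Icc s (s + h), HasDerivWithinAt g (g' r) (Ici 0) r)
    (hg' : ∀ r ∈ Icc s (s + h), HasDerivWithinAt g' (g'' r) (Ici 0) r)
    (hε : ∀ r ∈ Icc s (s + h), |g r| ≤ ε) (hL : ∀ r ∈ Icc s (s + h), |g'' r| ≤ L) :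
    |g' s| ≤ 2 * ε / h + L * h := by
  obtain ⟨r, hr, hslope⟩ := exists_hasDerivWithinAt_eq_slope hs (by linarith : s < s + h) hg
  have hsub : ∀ q ∈ Icc s r, q ∈ Icc s (s + h) := fun q hq => ⟨hq.1, hq.2.trans hr.2.le⟩
  have h1 := abs_sub_le_of_abs_deriv_le hs hr.1.le (fun q hq => hg' q (hsub q hq))
    (fun q hq => hL q (hsub q hq))
  have hL0 : 0 ≤ L := (abs_nonneg _).trans (hL s ⟨le_rfl, by linarith⟩)
  have h2 : |g' r| ≤ 2 * ε / h := by
    rw [hslope, add_sub_cancel_left, abs_div, abs_of_pos hh]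
    gcongr
    have h3 := hε s ⟨le_rfl, by linarith⟩
    have h4 := hε (s + h) ⟨by linarith, le_rfl⟩
    rw [abs_le] at *
    constructor <;> linarith [h3.1, h3.2, h4.1, h4.2]
  have h5 : L * (r - s) ≤ L * h := mul_le_mul_of_nonneg_left (by linarith [hr.2]) hL0
  have h6 := abs_sub_abs_le_abs_sub (g' s) (g' r)
  rw [abs_sub_comm] at h6
  linarith

/-- The mean value theorem for `J` gives a point where `g ^ 2 ≤ D ^ 2 / h`; the derivative bound
transports this to `s`. -/
theorem abs_le_of_energy_le {g g' J J' : ℝ → ℝ} {s h D L : ℝ} (hs : 0 ≤ s) (hh : 0 < h)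
    (hg : ∀ r ∈ Icc s (s + h), HasDerivWithinAt g (g' r) (Ici 0) r)
    (hJ : ∀ r ∈ Icc s (s + h), HasDerivWithinAt J (J' r) (Ici 0) r)
    (hgJ : ∀ r ∈ Icc s (s + h), g r ^ 2 ≤ J' r) (hD : 0 ≤ D) (hJD : J (s + h) - J s ≤ D ^ 2)
    (hL : ∀ r ∈ Icc s (s + h), |g' r| ≤ L) :
    |g s| ≤ D / Real.sqrt h + L * h := by
  obtain ⟨r, hr, hslope⟩ := exists_hasDerivWithinAt_eq_slope hs (by linarith : s < s + h) hJ
  have hsub : ∀ q ∈ Icc s r, q ∈ Icc s (s + h) := fun q hq => ⟨hq.1, hq.2.trans hr.2.le⟩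
  have h1 := abs_sub_le_of_abs_deriv_le hs hr.1.le (fun q hq => hg q (hsub q hq))
    (fun q hq => hL q (hsub q hq))
  have hL0 : 0 ≤ L := (abs_nonneg _).trans (hL s ⟨le_rfl, by linarith⟩)
  have h2 : |g r| ≤ D / Real.sqrt h := by
    refine abs_le_of_sq_le_sq ?_ (by positivity)
    rw [div_pow, Real.sq_sqrt hh.le]
    refine (hgJ r ⟨hr.1.le, hr.2.le⟩).trans ?_
    rw [hslope, add_sub_cancel_left]
    gcongr
  have h5 : L * (r - s) ≤ L * h := mul_le_mul_of_nonneg_left (by linarith [hr.2]) hL0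
  have h6 := abs_sub_abs_le_abs_sub (g s) (g r)
  rw [abs_sub_comm] at h6
  linarith

/-- The left side is the factor that the a priori bound acquires after one energy interpolation and
two Landau steps. Each step divides by the next size, so `h₃` is fixed before `h₂` and `h₂` before
`h₁`. -/
theorem exists_step_sizes {G τ l : ℝ} (hG : 0 < G) (hτ : 0 < τ) (hl : 0 < l) :
    ∃ h₁ h₂ h₃ : ℝ, (0 < h₁ ∧ h₁ ≤ 1) ∧ (0 < h₂ ∧ h₂ ≤ 1) ∧ (0 < h₃ ∧ h₃ ≤ 1) ∧
      l * (G * h₁) + (2 * (G * h₁) / h₂ + G * h₂)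
        + (2 * (2 * (G * h₁) / h₂ + G * h₂) / h₃ + G * h₃) ≤ τ := by
  have small : ∀ c > 0, ∃ h, (0 < h ∧ h ≤ 1) ∧ G * h ≤ c := fun c hc =>
    ⟨min 1 (c / G), ⟨by positivity, min_le_left _ _⟩, by
      calc G * min 1 (c / G) ≤ G * (c / G) := by gcongr; exact min_le_right _ _
        _ = c := by field_simp⟩
  obtain ⟨h₃, h3, h3'⟩ := small (τ / 6) (by positivity)
  have h3p := h3.1
  obtain ⟨h₂, h2, h2'⟩ := small (τ * h₃ / 24) (by positivity)
  have h2p := h2.1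
  obtain ⟨h₁, h1, h1'⟩ := small (min (τ * h₃ * h₂ / 48) (τ / (3 * l))) (by positivity)
  refine ⟨h₁, h₂, h₃, h1, h2, h3, ?_⟩
  have e1 : l * (G * h₁) ≤ τ / 3 := by
    calc l * (G * h₁) ≤ l * (τ / (3 * l)) := by gcongr; exact h1'.trans (min_le_right _ _)
      _ = τ / 3 := by field_simp
  have e2 : 2 * (G * h₁) / h₂ ≤ τ * h₃ / 24 := by
    rw [div_le_iff₀ h2.1]
    have := h1'.trans (min_le_left _ _)
    linarith
  have e3 : 2 * (2 * (G * h₁) / h₂ + G * h₂) / h₃ ≤ τ / 6 := by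
    rw [div_le_iff₀ h3.1]
    linarith
  have e4 : τ * h₃ ≤ τ := mul_le_of_le_one_right hτ.le h3.2
  linarith

/-! ### Consequences of persistent excitation for a fixed vector. -/

section Excitation

variable {H : Type*} [NormedAddCommGroup H] [InnerProductSpace ℝ H]

theorem abs_inner_le {v w : H} {B : ℝ} (hv : ‖v‖ ≤ B) : |inner ℝ v w| ≤ B * ‖w‖ :=
  (abs_real_inner_le_norm v w).trans (mul_le_mul_of_nonneg_right hv (norm_nonneg w))

theorem hasDerivWithinAt_inner_const {u u' : ℝ → H} {s : Set ℝ} {t : ℝ}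
    (h : HasDerivWithinAt u (u' t) s t) (ξ : H) :
    HasDerivWithinAt (fun r => inner ℝ (u r) ξ) (inner ℝ (u' t) ξ) s t := by
  simpa using h.inner ℝ (hasDerivWithinAt_const t s ξ)

/-- The integral of `⟪u', ξ⟫²` over a window is controlled by any uniform bound. -/
theorem excitation_integral_le {v : ℝ → H} {δ γ t : ℝ} {ξ : H} (hδ : 0 < δ)
    (hγ : ∀ s ∈ Icc t (t + δ), |inner ℝ (v s) ξ| ≤ γ) :
    1 / δ * ∫ s in t..(t + δ), inner ℝ (v s) ξ ^ 2 ≤ γ ^ 2 := by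
  have h := intervalIntegral.norm_integral_le_of_norm_le_const (a := t) (b := t + δ)
    (f := fun s => inner ℝ (v s) ξ ^ 2) (C := γ ^ 2) fun s hs => by
      rw [uIoc_of_le (by linarith)] at hs
      rw [Real.norm_eq_abs, abs_of_nonneg (sq_nonneg _), ← sq_abs]
      exact pow_le_pow_left₀ (abs_nonneg _) (hγ s ⟨hs.1.le, hs.2⟩) 2
  rw [add_sub_cancel_left, abs_of_pos hδ] at h
  have h1 := (le_abs_self _).trans h
  rw [one_div, ← div_eq_inv_mul, div_le_iff₀ hδ]
  exact h1

/-- If `⟪u', x⟫ + 2 ⟪u, a⟫ + b` is small along the line `x = ξ + (s - t) a` whose direction is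
small with respect to its origin, then the persistent excitation of `u'` makes `ξ` small. -/
theorem norm_le_of_excitation_window {u u' : ℝ → H} {B δ m L η ε t b q : ℝ} {ξ a : H}
    (ht : 0 ≤ t) (hδ : 0 < δ) (hm : 0 < m) (hL1 : 1 ≤ L) (hLδ : δ ≤ L) (hε : 0 ≤ ε)
    (hB : 0 ≤ B) (hη : 0 ≤ η)
    (hu' : ∀ s, 0 ≤ s → HasDerivWithinAt u (u' s) (Ici 0) s)
    (hub : ∀ s, 0 ≤ s → ‖u s‖ ≤ B) (hub' : ∀ s, 0 ≤ s → ‖u' s‖ ≤ B)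
    (hBη : 6 * B * η ≤ m / 4) (hBL : 2 * B ≤ m / 4 * L)
    (hpe : m ^ 2 * ‖ξ‖ ^ 2 ≤ q + 1 / δ * ∫ s in t..(t + δ), inner ℝ (u' s) ξ ^ 2)
    (hq : q ≤ ε ^ 2) (ha : L * ‖a‖ ≤ η * ‖ξ‖)
    (hf : ∀ s ∈ Icc t (t + L),
      |inner ℝ (u' s) (ξ + (s - t) • a) + 2 * inner ℝ (u s) a + b| ≤ ε) :
    ‖ξ‖ ≤ 5 / m * ε ∧ |b| ≤ ε + m / 2 * ‖ξ‖ := by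
  have hξ := norm_nonneg ξ
  have ha0 := norm_nonneg a
  have hL0 : 0 < L := by linarith
  have haL : ‖a‖ ≤ L * ‖a‖ := le_mul_of_one_le_left ha0 hL1
  have h1 : ∀ s ∈ Icc t (t + L), |inner ℝ (u' s) ξ + b| ≤ ε + 3 * B * η * ‖ξ‖ := by
    intro s hs
    have hs0 := ht.trans hs.1
    have e1 := hf s hs
    have e2 : |inner ℝ (u' s) ((s - t) • a)| ≤ B * (η * ‖ξ‖) := by
      refine (abs_inner_le (hub' s hs0)).trans (mul_le_mul_of_nonneg_left ?_ hB)
      rw [norm_smul, Real.norm_eq_abs, abs_of_nonneg (by linarith [hs.1])]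
      exact (mul_le_mul_of_nonneg_right (by linarith [hs.2]) ha0).trans ha
    have e3 : |inner ℝ (u s) a| ≤ B * (η * ‖ξ‖) :=
      (abs_inner_le (hub s hs0)).trans (mul_le_mul_of_nonneg_left (haL.trans ha) hB)
    rw [inner_add_right] at e1
    rw [abs_le] at *
    constructor <;> linarith [e1.1, e1.2, e2.1, e2.2, e3.1, e3.2]
  -- The mean of `⟪u', ξ⟫` over length `L` is a difference of values of `⟪u, ξ⟫` over `L`, hence at
  -- most `m / 4 * ‖ξ‖`; this isolates `b`.
  have hb : |b| ≤ ε + 3 * B * η * ‖ξ‖ + m / 4 * ‖ξ‖ := by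
    obtain ⟨s, hs, hslope⟩ := exists_hasDerivWithinAt_eq_slope
      (f := fun s => inner ℝ (u s) ξ + b * s) ht
      (by linarith : t < t + L) fun s hs => by
        simpa using (hasDerivWithinAt_inner_const (hu' s (ht.trans hs.1)) ξ).fun_add
          ((hasDerivWithinAt_id s (Ici 0)).const_mul b)
    have e1 := h1 s ⟨hs.1.le, hs.2.le⟩
    have e2 : |inner ℝ (u (t + L)) ξ - inner ℝ (u t) ξ| ≤ m / 4 * ‖ξ‖ * L := by
      have f1 := abs_inner_le (w := ξ) (hub (t + L) (by linarith))
      have f2 := abs_inner_le (w := ξ) (hub t ht)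
      have f3 := mul_le_mul_of_nonneg_right hBL hξ
      have f4 := abs_sub (inner ℝ (u (t + L)) ξ) (inner ℝ (u t) ξ)
      linarith
    rw [hslope] at e1
    have e3 : (inner ℝ (u (t + L)) ξ + b * (t + L) - (inner ℝ (u t) ξ + b * t)) / (t + L - t)
        = (inner ℝ (u (t + L)) ξ - inner ℝ (u t) ξ) / L + b := by
      rw [add_sub_cancel_left]; field_simp; ring
    rw [e3] at e1
    have e4 : |(inner ℝ (u (t + L)) ξ - inner ℝ (u t) ξ) / L| ≤ m / 4 * ‖ξ‖ := by
      rw [abs_div, abs_of_pos hL0, div_le_iff₀ hL0]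
      exact e2
    rw [abs_le] at *
    constructor <;> linarith [e1.1, e1.2, e4.1, e4.2]
  have hBη' : 6 * B * η * ‖ξ‖ ≤ m / 4 * ‖ξ‖ := mul_le_mul_of_nonneg_right hBη hξ
  have hmξ : 0 ≤ m * ‖ξ‖ := by positivity
  have hBη0 : 0 ≤ B * η * ‖ξ‖ := by positivity
  refine ⟨?_, hb.trans (by linarith)⟩
  have h2 := excitation_integral_le (v := u') (γ := 2 * ε + m / 2 * ‖ξ‖) (ξ := ξ) (t := t) hδ
    fun s hs => by
      have e1 := h1 s ⟨hs.1, by linarith [hs.2]⟩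
      rw [abs_le] at *
      constructor <;> linarith [e1.1, e1.2]
  -- With `X = m * ‖ξ‖` the bounds read `X² ≤ ε² + (2 ε + X / 2)²`, which forces `X² ≤ 18 ε²`.
  have h3 : (m * ‖ξ‖) ^ 2 ≤ (5 * ε) ^ 2 := by
    nlinarith [sq_nonneg (2 * ε - m / 2 * ‖ξ‖)]
  have h4 := abs_le_of_sq_le_sq' h3 (by positivity)
  rw [div_mul_eq_mul_div, le_div_iff₀ hm]
  linarith [h4.2]

end Excitation

/-! ### Observability of the homogeneous system on a window. -/

section Observability

variable {H : Type*} [NormedAddCommGroup H] [InnerProductSpace ℝ H] {l : ℕ}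

/-- The excitation condition tests fixed vectors, while the position moves. A line with direction
`a` reaches within time `2 * R` a point `ξ` with `R * ‖a‖ ≤ ‖ξ‖`; from there the drift during the
test window is negligible. Bounds on `ξ` and `b` then give back `a` and `x`. -/
theorem exists_line_bound {u u' : ℝ → H} {B δ m : ℝ} (q : H → ℝ) (hδ : 0 < δ) (hm : 0 < m)
    (hB : 0 < B) (hu' : ∀ s, 0 ≤ s → HasDerivWithinAt u (u' s) (Ici 0) s)
    (hub : ∀ s, 0 ≤ s → ‖u s‖ ≤ B) (hub' : ∀ s, 0 ≤ s → ‖u' s‖ ≤ B)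
    (hpe : ∀ t, 0 ≤ t → ∀ ξ, m ^ 2 * ‖ξ‖ ^ 2 ≤
      q ξ + 1 / δ * ∫ s in t..(t + δ), inner ℝ (u' s) ξ ^ 2) :
    ∃ Λ > 0, ∃ K > 0, ∀ t, 0 ≤ t → ∀ ε, 0 ≤ ε → ∀ (x a : H) (b : ℝ),
      (∀ s ∈ Icc t (t + Λ),
        |inner ℝ (u' s) (x + (s - t) • a) + 2 * inner ℝ (u s) a + b| ≤ ε) →
      (∀ s ∈ Icc t (t + Λ), q (x + (s - t) • a) ≤ ε ^ 2) →
      ‖x‖ ≤ K * ε ∧ ‖a‖ ≤ K * ε ∧ |b| ≤ K * ε := by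
  -- `L` covers the excitation window and is long enough for averaging `u'`; `η` is such that the
  -- drift terms amount to `m / 4 * ‖ξ‖`.
  set L := max δ 1 + 8 * B / m with hL
  set η := m / (24 * B) with hη
  have hηpos : 0 < η := by positivity
  have hdiv : 0 < 8 * B / m := by positivity
  have hLδ : δ ≤ L := by linarith [le_max_left δ 1]
  have hL1 : 1 ≤ L := by linarith [le_max_right δ 1]
  have hL0 : 0 < L := by linarith
  have hBη : 6 * B * η ≤ m / 4 := le_of_eq (by rw [hη]; field_simp; ring)
  have hBL : 2 * B ≤ m / 4 * L := by
    have h1 : m / 4 * (8 * B / m) = 2 * B := by field_simp; ring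
    have h2 : 0 ≤ m / 4 * max δ 1 := mul_nonneg (by positivity) (by positivity)
    rw [hL, mul_add]
    linarith
  set R := L / η with hR
  have hRpos : 0 < R := by positivity
  have hRη : R * η = L := by rw [hR]; field_simp
  refine ⟨2 * R + L, by positivity, 1 + (3 + 1 / R + m / 2) * (5 / m), by positivity,
    fun t ht ε hε x a b hf hq => ?_⟩
  have ha0 := norm_nonneg a
  have hchoice : ∃ r, 0 ≤ r ∧ r ≤ 2 * R ∧ R * ‖a‖ ≤ ‖x + r • a‖ := by
    rcases le_total (R * ‖a‖) ‖x‖ with h | h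
    · exact ⟨0, le_rfl, by positivity, by simpa using h⟩
    · refine ⟨2 * R, by positivity, le_rfl, ?_⟩
      have h1 := norm_sub_le (x + (2 * R) • a) x
      rw [add_sub_cancel_left, norm_smul, Real.norm_eq_abs, abs_of_pos (by positivity)] at h1
      linarith
  obtain ⟨r, hr0, hr1, hr⟩ := hchoice
  set ξ := x + r • a with hξ
  have hLa : L * ‖a‖ ≤ η * ‖ξ‖ := by
    rw [← hRη, mul_comm R η, mul_assoc]
    exact mul_le_mul_of_nonneg_left hr hηpos.le
  have htr : 0 ≤ t + r := by linarith
  obtain ⟨h1, h2⟩ := norm_le_of_excitation_window (b := b) htr hδ hm hL1 hLδ hε hB.le hηpos.le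
    hu' hub hub' hBη hBL (hpe (t + r) htr ξ)
    (by simpa using hq (t + r) ⟨by linarith, by linarith⟩) hLa (fun s hs => by
      have := hf s ⟨by linarith [hs.1], by linarith [hs.2]⟩
      rwa [show x + (s - t) • a = ξ + (s - (t + r)) • a by
        rw [hξ, add_assoc, ← add_smul]; congr 2; ring] at this)
  have hξ0 := norm_nonneg ξ
  have h3 : ‖a‖ ≤ 1 / R * ‖ξ‖ := by
    rw [one_div, ← div_eq_inv_mul, le_div_iff₀ hRpos]
    linarith
  have h4 : ‖x‖ ≤ 3 * ‖ξ‖ := by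
    have e1 := norm_sub_le ξ (r • a)
    rw [hξ, add_sub_cancel_right, norm_smul, Real.norm_eq_abs, abs_of_nonneg hr0] at e1
    have e2 : r * ‖a‖ ≤ 2 * R * ‖a‖ := mul_le_mul_of_nonneg_right hr1 ha0
    linarith
  have p1 : 0 ≤ 1 / R * ‖ξ‖ := by positivity
  have p2 : 0 ≤ m / 2 * ‖ξ‖ := by positivity
  have h5 : (3 + 1 / R + m / 2) * ‖ξ‖ ≤ (3 + 1 / R + m / 2) * (5 / m * ε) :=
    mul_le_mul_of_nonneg_left h1 (by positivity)
  have h6 : (1 + (3 + 1 / R + m / 2) * (5 / m)) * ε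
      = ε + (3 + 1 / R + m / 2) * (5 / m * ε) := by ring
  rw [h6]
  refine ⟨?_, ?_, ?_⟩ <;> linarith

/-- The homogeneous augmented system along a sliding window starting at time `t`: the position
moves on the line `x + (s - t) a`, and `y`, `σ` are the last coordinates. The function `J`
dominates the energy of the outputs `y` and `N (x + (s - t) a)` on a window of length `Λ`. -/
structure IsWindowTrajectory (N : H →L[ℝ] (Fin l → ℝ)) (w : H) (u : ℝ → H) (t Λ : ℝ) (x a : H)
    (b : ℝ) (y σ J J' : ℝ → ℝ) : Prop where
  y_deriv : ∀ s, 0 ≤ s → t ≤ s → HasDerivWithinAt y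
    (inner ℝ (u s) (x + (s - t) • a) - inner ℝ w a + σ s) (Ici 0) s
  σ_deriv : ∀ s, 0 ≤ s → t ≤ s → HasDerivWithinAt σ (inner ℝ (u s) a + b) (Ici 0) s
  J_deriv : ∀ s, 0 ≤ s → t ≤ s → HasDerivWithinAt J (J' s) (Ici 0) s
  energy_le : ∀ s ∈ Icc t (t + Λ),
    y s ^ 2 + N (x + (s - t) • a) ⬝ᵥ N (x + (s - t) • a) ≤ J' s

theorem hasDerivWithinAt_line (x a : H) (t s : ℝ) :
    HasDerivWithinAt (fun s : ℝ => x + (s - t) • a) a (Ici 0) s := by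
  simpa using (((hasDerivWithinAt_id s (Ici (0 : ℝ))).sub_const t).smul_const a).const_add x

-- The derivatives of `y`, `y'`, `y''` and of each component of `N` along the line are at most `G *
-- M`, where `M` is the size of the state. Energy interpolation bounds `y` and `N`, then two Landau
-- steps bound `y'` and `y''`; each of the three uses at most one unit of the extra window length
-- `3`. Short steps make the coefficient of `M` as small as desired, at the cost of a large `c`.
set_option maxHeartbeats 400000 in
theorem exists_output_bound (N : H →L[ℝ] (Fin l → ℝ)) (w : H) {u u' u'' : ℝ → H} {B : ℝ}
    (hB : 0 < B) (hu' : ∀ s, 0 ≤ s → HasDerivWithinAt u (u' s) (Ici 0) s)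
    (hu'' : ∀ s, 0 ≤ s → HasDerivWithinAt u' (u'' s) (Ici 0) s)
    (hub : ∀ s, 0 ≤ s → ‖u s‖ ≤ B) (hub' : ∀ s, 0 ≤ s → ‖u' s‖ ≤ B)
    (hub'' : ∀ s, 0 ≤ s → ‖u'' s‖ ≤ B) {Λ τ : ℝ} (hΛ : 0 < Λ) (hτ : 0 < τ) :
    ∃ c > 0, ∀ t, 0 ≤ t → ∀ (x a : H) (b : ℝ) (y σ J J' : ℝ → ℝ),
      IsWindowTrajectory N w u t (Λ + 3) x a b y σ J J' →
      ∀ D, 0 ≤ D → J (t + (Λ + 3)) - J t ≤ D ^ 2 →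
      ∀ ε, ε = c * D + τ * (‖x‖ + ‖a‖ + |y t| + |σ t| + |b|) →
        |y t| ≤ ε ∧ |inner ℝ (u t) x - inner ℝ w a + σ t| ≤ ε ∧
        (∀ s ∈ Icc t (t + Λ),
          |inner ℝ (u' s) (x + (s - t) • a) + 2 * inner ℝ (u s) a + b| ≤ ε) ∧
        (∀ s ∈ Icc t (t + Λ), N (x + (s - t) • a) ⬝ᵥ N (x + (s - t) • a) ≤ ε ^ 2) := by
  set T := Λ + 3 with hT
  have hTpos : 0 < T := by positivity
  set G := (2 * B * (1 + T) + 1 + ‖w‖ + T * (B + 1)) + 4 * B + ‖N‖ with hG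
  have hGpos : 0 < G := by positivity
  -- The weight `l + 1` absorbs the sum over the `l` components of `N`, through `l * ε₁ ^ 2 ≤ ((l +
  -- 1) * ε₁) ^ 2`.
  obtain ⟨h₁, h₂, h₃, h1, h2, h3, hsum⟩ := exists_step_sizes hGpos hτ
    (by positivity : (0 : ℝ) < l + 1)
  have h1p := h1.1
  have h2p := h2.1
  have h3p := h3.1
  set c₁ := 1 / Real.sqrt h₁ with hc₁
  have hc₁pos : 0 < c₁ := by positivity
  set c₂ := 2 * c₁ / h₂ with hc₂
  set c₃ := 2 * c₂ / h₃ with hc₃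
  have hc₂pos : 0 < c₂ := by positivity
  have hc₃pos : 0 < c₃ := by positivity
  refine ⟨(l + 1) * c₁ + c₂ + c₃, by positivity,
    fun t ht x a b y σ J J' h D hD hJD ε hε => ?_⟩
  set M := ‖x‖ + ‖a‖ + |y t| + |σ t| + |b| with hM
  have n1 := norm_nonneg x
  have n2 := norm_nonneg a
  have n3 := abs_nonneg (y t)
  have n4 := abs_nonneg (σ t)
  have n5 := abs_nonneg b
  have n6 := norm_nonneg w
  have n7 := norm_nonneg N
  have hM0 : 0 ≤ M := by positivity
  have hxM : ‖x‖ ≤ M := by linarith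
  have haM : ‖a‖ ≤ M := by linarith
  have hσM : |σ t| ≤ M := by linarith
  have hbM : |b| ≤ M := by linarith
  have pos : ∀ s ∈ Icc t (t + T), 0 ≤ s := fun s hs => ht.trans hs.1
  have hline : ∀ s ∈ Icc t (t + T), ‖x + (s - t) • a‖ ≤ (1 + T) * M := by
    intro s hs
    have e1 := norm_add_le x ((s - t) • a)
    rw [norm_smul, Real.norm_eq_abs, abs_of_nonneg (by linarith [hs.1])] at e1
    have e2 : (s - t) * ‖a‖ ≤ T * M := mul_le_mul (by linarith [hs.2]) haM n2 hTpos.le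
    linarith
  have hinner : ∀ v : H, ‖v‖ ≤ B → ∀ s ∈ Icc t (t + T),
      |inner ℝ v (x + (s - t) • a)| ≤ B * (1 + T) * M := fun v hv s hs => by
    rw [mul_assoc]
    exact (abs_inner_le hv).trans (mul_le_mul_of_nonneg_left (hline s hs) hB.le)
  have hinner' : ∀ v : H, ‖v‖ ≤ B → |inner ℝ v a| ≤ B * M := fun v hv =>
    (abs_inner_le hv).trans (mul_le_mul_of_nonneg_left haM hB.le)
  have hσ : ∀ s ∈ Icc t (t + T), |σ s| ≤ (1 + T * (B + 1)) * M := by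
    intro s hs
    have e1 := abs_sub_le_of_abs_deriv_le (L := (B + 1) * M) ht hs.1
      (fun r hr => h.σ_deriv r (ht.trans hr.1) hr.1) (fun r hr => by
        have := hinner' (u r) (hub r (ht.trans hr.1))
        refine (abs_add_le _ _).trans ?_
        linarith)
    have e2 := abs_sub_abs_le_abs_sub (σ s) (σ t)
    have e3 : (B + 1) * M * (s - t) ≤ (B + 1) * M * T :=
      mul_le_mul_of_nonneg_left (by linarith [hs.2]) (by positivity)
    linarith
  have hw : |inner ℝ w a| ≤ ‖w‖ * M :=
    (abs_inner_le le_rfl).trans (mul_le_mul_of_nonneg_left haM n6)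
  have hBM : 0 ≤ B * M := by positivity
  have hBTM : 0 ≤ B * (1 + T) * M := by positivity
  have hTBM : 0 ≤ T * (B + 1) * M := by positivity
  have hwM : 0 ≤ ‖w‖ * M := by positivity
  have hNM : 0 ≤ ‖N‖ * M := by positivity
  have hGM : G * M = 2 * (B * (1 + T) * M) + M + ‖w‖ * M + T * (B + 1) * M + 4 * (B * M)
      + ‖N‖ * M := by rw [hG]; ring
  set y' : ℝ → ℝ := fun s => inner ℝ (u s) (x + (s - t) • a) - inner ℝ w a + σ s with hy'
  set f : ℝ → ℝ := fun s => inner ℝ (u' s) (x + (s - t) • a) + 2 * inner ℝ (u s) a + b with hf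
  set f' : ℝ → ℝ := fun s => inner ℝ (u'' s) (x + (s - t) • a) + 3 * inner ℝ (u' s) a with hf'
  have hyd : ∀ s ∈ Icc t (t + T), HasDerivWithinAt y (y' s) (Ici 0) s := fun s hs =>
    h.y_deriv s (pos s hs) hs.1
  have hy'd : ∀ s ∈ Icc t (t + T), HasDerivWithinAt y' (f s) (Ici 0) s := fun s hs => by
    have e1 := (((hu' s (pos s hs)).inner ℝ (hasDerivWithinAt_line x a t s)).sub_const
      (inner ℝ w a)).fun_add (h.σ_deriv s (pos s hs) hs.1)
    exact e1.congr_deriv (by simp only [hf]; ring)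
  have hfd : ∀ s ∈ Icc t (t + T), HasDerivWithinAt f (f' s) (Ici 0) s := fun s hs => by
    have e1 := (((hu'' s (pos s hs)).inner ℝ (hasDerivWithinAt_line x a t s)).fun_add
      ((hasDerivWithinAt_inner_const (hu' s (pos s hs)) a).const_mul 2)).add_const b
    exact e1.congr_deriv (by simp only [hf']; ring)
  have hy'b : ∀ s ∈ Icc t (t + T), |y' s| ≤ G * M := fun s hs => by
    have e1 := hinner (u s) (hub s (pos s hs)) s hs
    have e2 := hσ s hs
    simp only [hy']
    rw [abs_le] at *
    constructor <;> linarith [e1.1, e1.2, e2.1, e2.2, hw.1, hw.2]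
  have hfb : ∀ s ∈ Icc t (t + T), |f s| ≤ G * M := fun s hs => by
    have e1 := hinner (u' s) (hub' s (pos s hs)) s hs
    have e2 := hinner' (u s) (hub s (pos s hs))
    simp only [hf]
    rw [abs_le] at *
    constructor <;> linarith [e1.1, e1.2, e2.1, e2.2, hbM.1, hbM.2]
  have hf'b : ∀ s ∈ Icc t (t + T), |f' s| ≤ G * M := fun s hs => by
    have e1 := hinner (u'' s) (hub'' s (pos s hs)) s hs
    have e2 := hinner' (u' s) (hub' s (pos s hs))
    simp only [hf']
    rw [abs_le] at *
    constructor <;> linarith [e1.1, e1.2, e2.1, e2.2]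
  have hJ' : ∀ s ∈ Icc t (t + T), 0 ≤ J' s := fun s hs =>
    (add_nonneg (sq_nonneg _) (dotProduct_self_nonneg _)).trans (h.energy_le s hs)
  have hJmono : ∀ r s, t ≤ r → r ≤ s → s ≤ t + T → J r ≤ J s := fun r s hr hrs hs =>
    le_of_hasDerivWithinAt_nonneg (ht.trans hr) hrs
      (fun q hq => h.J_deriv q (ht.trans (hr.trans hq.1)) (hr.trans hq.1))
      (fun q hq => hJ' q ⟨hr.trans hq.1, hq.2.trans hs⟩)
  have hJs : ∀ s ∈ Icc t (t + (Λ + 2)), J (s + h₁) - J s ≤ D ^ 2 := fun s hs => by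
    have e1 := hJmono t s le_rfl hs.1 (by linarith [hs.2])
    have e2 := hJmono (s + h₁) (t + T) (by linarith [hs.1]) (by linarith [hs.2, h1.2]) le_rfl
    linarith
  set ε₁ := c₁ * D + G * h₁ * M with hε₁
  set ε₂ := 2 * ε₁ / h₂ + G * h₂ * M with hε₂
  set ε₃ := 2 * ε₂ / h₃ + G * h₃ * M with hε₃
  have hε₁0 : 0 ≤ ε₁ := by positivity
  have hε₂0 : 0 ≤ ε₂ := by positivity
  have hε₃0 : 0 ≤ ε₃ := by positivity
  have b1 : ∀ (g g' : ℝ → ℝ), (∀ s ∈ Icc t (t + T), HasDerivWithinAt g (g' s) (Ici 0) s) →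
      (∀ s ∈ Icc t (t + T), |g' s| ≤ G * M) → (∀ s ∈ Icc t (t + T), g s ^ 2 ≤ J' s) →
      ∀ s ∈ Icc t (t + (Λ + 2)), |g s| ≤ ε₁ := fun g g' hg hg' hgJ s hs => by
    have sub : ∀ r ∈ Icc s (s + h₁), r ∈ Icc t (t + T) := fun r hr =>
      ⟨hs.1.trans hr.1, by linarith [hr.2, hs.2, h1.2]⟩
    have := abs_le_of_energy_le (ht.trans hs.1) h1.1 (fun r hr => hg r (sub r hr))
      (fun r hr => h.J_deriv r (pos r (sub r hr)) (sub r hr).1) (fun r hr => hgJ r (sub r hr))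
      hD (hJs s hs) (fun r hr => hg' r (sub r hr))
    calc |g s| ≤ _ := this
      _ = ε₁ := by rw [hε₁, hc₁]; ring
  have by1 := b1 y y' hyd hy'b fun s hs =>
    (le_add_of_nonneg_right (dotProduct_self_nonneg _)).trans (h.energy_le s hs)
  have by2 : ∀ s ∈ Icc t (t + (Λ + 1)), |y' s| ≤ ε₂ := fun s hs => by
    have sub : ∀ r ∈ Icc s (s + h₂), r ∈ Icc t (t + (Λ + 2)) := fun r hr =>
      ⟨hs.1.trans hr.1, by linarith [hr.2, hs.2, h2.2]⟩
    have sub' : ∀ r ∈ Icc s (s + h₂), r ∈ Icc t (t + T) := fun r hr =>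
      ⟨(sub r hr).1, by linarith [(sub r hr).2]⟩
    have := abs_deriv_le_of_abs_le (ht.trans hs.1) h2.1 (fun r hr => hyd r (sub' r hr))
      (fun r hr => hy'd r (sub' r hr)) (fun r hr => by1 r (sub r hr))
      (fun r hr => hfb r (sub' r hr))
    calc |y' s| ≤ _ := this
      _ = ε₂ := by rw [hε₂]; ring
  have by3 : ∀ s ∈ Icc t (t + Λ), |f s| ≤ ε₃ := fun s hs => by
    have sub : ∀ r ∈ Icc s (s + h₃), r ∈ Icc t (t + (Λ + 1)) := fun r hr =>
      ⟨hs.1.trans hr.1, by linarith [hr.2, hs.2, h3.2]⟩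
    have sub' : ∀ r ∈ Icc s (s + h₃), r ∈ Icc t (t + T) := fun r hr =>
      ⟨(sub r hr).1, by linarith [(sub r hr).2]⟩
    have := abs_deriv_le_of_abs_le (ht.trans hs.1) h3.1 (fun r hr => hy'd r (sub' r hr))
      (fun r hr => hfd r (sub' r hr)) (fun r hr => by2 r (sub r hr))
      (fun r hr => hf'b r (sub' r hr))
    calc |f s| ≤ _ := this
      _ = ε₃ := by rw [hε₃]; ring
  have bN : ∀ s ∈ Icc t (t + Λ), ∀ i, |N (x + (s - t) • a) i| ≤ ε₁ := fun s hs i => by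
    refine b1 (fun s => N (x + (s - t) • a) i) (fun _ => N a i) (fun r _ => ?_) (fun r _ => ?_)
      (fun r hr => ?_) s ⟨hs.1, by linarith [hs.2]⟩
    · have := N.hasFDerivAt.comp_hasDerivWithinAt r (hasDerivWithinAt_line x a t r)
      exact hasDerivWithinAt_pi.1 this i
    · have e1 := (norm_le_pi_norm (N a) i).trans (N.le_opNorm a)
      rw [Real.norm_eq_abs] at e1
      have e2 := mul_le_mul_of_nonneg_left haM n7
      linarith
    · refine le_trans ?_ (h.energy_le r hr)
      refine le_add_of_nonneg_of_le (sq_nonneg _) ?_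
      rw [pow_two]
      exact Finset.single_le_sum (f := fun i => N (x + (r - t) • a) i * N (x + (r - t) • a) i)
        (fun i _ => mul_self_nonneg _) (Finset.mem_univ i)
  have htot : (l + 1) * ε₁ + ε₂ + ε₃ ≤ ε := by
    have e1 : (l + 1) * ε₁ + ε₂ + ε₃ = ((l + 1) * c₁ + c₂ + c₃) * D
        + ((l + 1) * (G * h₁) + (2 * (G * h₁) / h₂ + G * h₂)
        + (2 * (2 * (G * h₁) / h₂ + G * h₂) / h₃ + G * h₃)) * M := by
      rw [hε₃, hε₂, hε₁, hc₃, hc₂]; ring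
    rw [e1, hε]
    gcongr
  have hl0 : (0 : ℝ) ≤ l * ε₁ := by positivity
  have hle₁ : ε₁ ≤ ε := by linarith
  refine ⟨(by1 t ⟨le_rfl, by linarith⟩).trans hle₁, ?_, fun s hs => (by3 s hs).trans (by linarith),
    fun s hs => ?_⟩
  · have := by2 t ⟨le_rfl, by linarith⟩
    simp only [hy', sub_self, zero_smul, add_zero] at this
    linarith
  · have e1 : N (x + (s - t) • a) ⬝ᵥ N (x + (s - t) • a) ≤ ∑ _i : Fin l, ε₁ ^ 2 :=
      Finset.sum_le_sum fun i _ => by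
        rw [← pow_two]
        exact sq_le_sq' (abs_le.1 (bN s hs i)).1 (abs_le.1 (bN s hs i)).2
    rw [Finset.sum_const, Finset.card_univ, Fintype.card_fin, nsmul_eq_mul] at e1
    refine e1.trans (le_trans ?_ (pow_le_pow_left₀ (by positivity)
      (by linarith : (l + 1) * ε₁ ≤ ε) 2))
    have e2 : (0 : ℝ) ≤ l := by positivity
    have e3 := sq_nonneg ε₁
    rw [mul_pow]
    refine mul_le_mul_of_nonneg_right ?_ e3
    rw [add_sq]
    linarith only [e2, sq_nonneg (l : ℝ)]

/-- The size `M` of the state is at most `K' * ε`, and `ε` itself contains `M`, with coefficient `1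
/ (2 * K')`. Half of `M` is therefore absorbed, leaving a multiple of the output energy. -/
theorem exists_window_bound (N : H →L[ℝ] (Fin l → ℝ)) (w : H) {u u' u'' : ℝ → H} {B δ m : ℝ}
    (hδ : 0 < δ) (hm : 0 < m)
    (hB : 0 < B) (hu' : ∀ s, 0 ≤ s → HasDerivWithinAt u (u' s) (Ici 0) s)
    (hu'' : ∀ s, 0 ≤ s → HasDerivWithinAt u' (u'' s) (Ici 0) s)
    (hub : ∀ s, 0 ≤ s → ‖u s‖ ≤ B) (hub' : ∀ s, 0 ≤ s → ‖u' s‖ ≤ B)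
    (hub'' : ∀ s, 0 ≤ s → ‖u'' s‖ ≤ B)
    (hpe : ∀ t, 0 ≤ t → ∀ ξ, m ^ 2 * ‖ξ‖ ^ 2 ≤
      N ξ ⬝ᵥ N ξ + 1 / δ * ∫ s in t..(t + δ), inner ℝ (u' s) ξ ^ 2) :
    ∃ Λ > 0, ∃ K > 0, ∀ t, 0 ≤ t → ∀ (x a : H) (b : ℝ) (y σ J J' : ℝ → ℝ),
      IsWindowTrajectory N w u t Λ x a b y σ J J' →
      ‖x‖ ^ 2 + ‖a‖ ^ 2 + y t ^ 2 + σ t ^ 2 + b ^ 2 ≤ K * (J (t + Λ) - J t) := by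
  obtain ⟨Λ, hΛ, K, hK, hline⟩ := exists_line_bound (fun ξ => N ξ ⬝ᵥ N ξ) hδ hm hB hu' hub hub' hpe
  -- Three terms `K` come from `x`, `a`, `b`, one unit from `y`, and the rest from `σ`, which is
  -- recovered from `y'` by removing `⟪u, x⟫ - ⟪w, a⟫`.
  set K' := 3 * K + 2 + B * K + ‖w‖ * K with hK'
  have hK'pos : 0 < K' := by positivity
  obtain ⟨c, hc, hout⟩ := exists_output_bound N w hB hu' hu'' hub hub' hub'' hΛ
    (by positivity : 0 < 1 / (2 * K'))
  refine ⟨Λ + 3, by positivity, (2 * K' * c) ^ 2, by positivity,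
    fun t ht x a b y σ J J' h => ?_⟩
  have hΔ : 0 ≤ J (t + (Λ + 3)) - J t := sub_nonneg.2 <|
    le_of_hasDerivWithinAt_nonneg ht (by linarith)
      (fun s hs => h.J_deriv s (ht.trans hs.1) hs.1)
      (fun s hs => (add_nonneg (sq_nonneg _) (dotProduct_self_nonneg _)).trans (h.energy_le s hs))
  set D := Real.sqrt (J (t + (Λ + 3)) - J t) with hD
  have hD2 : D ^ 2 = J (t + (Λ + 3)) - J t := Real.sq_sqrt hΔ
  have hD0 : 0 ≤ D := Real.sqrt_nonneg _
  set M := ‖x‖ + ‖a‖ + |y t| + |σ t| + |b| with hM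
  have n1 := norm_nonneg x
  have n2 := norm_nonneg a
  have n3 := abs_nonneg (y t)
  have n4 := abs_nonneg (σ t)
  have n5 := abs_nonneg b
  have hM0 : 0 ≤ M := by positivity
  set ε := c * D + 1 / (2 * K') * M with hε
  have hε0 : 0 ≤ ε := by positivity
  obtain ⟨o1, o2, o3, o4⟩ := hout t ht x a b y σ J J' h D hD0 hD2.ge ε rfl
  obtain ⟨l1, l2, l3⟩ := hline t ht ε hε0 x a b o3 o4
  have hσ : |σ t| ≤ ε + B * (K * ε) + ‖w‖ * (K * ε) := by
    have e1 := (abs_inner_le (w := x) (hub t ht)).trans (mul_le_mul_of_nonneg_left l1 hB.le)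
    have e2 := (abs_inner_le (v := w) (w := a) le_rfl).trans
      (mul_le_mul_of_nonneg_left l2 (norm_nonneg w))
    rw [abs_le] at *
    constructor <;> linarith [e1.1, e1.2, e2.1, e2.2, o2.1, o2.2]
  have hMε : M ≤ K' * ε := by
    rw [hK']
    linarith
  have hMD : M ≤ 2 * K' * c * D := by
    have : K' * ε = K' * c * D + M / 2 := by rw [hε]; field_simp
    linarith
  rw [← hD2, ← mul_pow]
  refine le_trans ?_ (pow_le_pow_left₀ hM0 hMD 2)
  rw [hM, ← sq_abs (y t), ← sq_abs (σ t), ← sq_abs b]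
  nlinarith [mul_nonneg n1 n2, mul_nonneg n1 n3, mul_nonneg n1 n4, mul_nonneg n1 n5,
    mul_nonneg n2 n3, mul_nonneg n2 n4, mul_nonneg n2 n5, mul_nonneg n3 n4, mul_nonneg n3 n5,
    mul_nonneg n4 n5]

end Observability

/-! ### The augmented range-measurement system. -/

section Augmented

variable {n l : ℕ}

theorem stateMatrix_mulVec (z : Fin l → Vec n) (α : Fin l → ℝ) (u : Vec n)
    (X : StateIdx n → ℝ) :
    stateMatrix z α u *ᵥ X = Sum.elim (fun j => X (Sum.inr (Sum.inl j))) (Sum.elim 0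
      ![inner ℝ u (WithLp.toLp 2 fun j => X (Sum.inl j))
          - inner ℝ (weightedSource z α) (WithLp.toLp 2 fun j => X (Sum.inr (Sum.inl j)))
          + X (Sum.inr (Sum.inr 1)),
        inner ℝ u (WithLp.toLp 2 fun j => X (Sum.inr (Sum.inl j))) + X (Sum.inr (Sum.inr 2)),
        0]) := by
  ext i
  rcases i with j | j | j
  · simp [stateMatrix, mulVec, dotProduct, Fintype.sum_sum_type, Matrix.one_apply]
  · simp [stateMatrix, mulVec, dotProduct, Fintype.sum_sum_type]
  · fin_cases j <;>
    simp [stateMatrix, mulVec, dotProduct, Fintype.sum_sum_type, Fin.sum_univ_three,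
      PiLp.inner_apply, mul_comm]
    ring

theorem outputMatrix_mulVec (z : Fin l → Vec n) (α : Fin l → ℝ) (X : StateIdx n → ℝ) :
    outputMatrix z α *ᵥ X = Sum.elim (fun _ => X (Sum.inr (Sum.inr 0)))
      ((weightMatrix α * (sourceMatrix z)ᵀ) *ᵥ fun j => X (Sum.inl j)) := by
  ext i
  rcases i with j | j
  · fin_cases j
    simp [outputMatrix, mulVec, dotProduct, Fintype.sum_sum_type, Fin.sum_univ_three]
  · simp [outputMatrix, mulVec, dotProduct, Fintype.sum_sum_type]

theorem abs_stateMatrix_le (z : Fin l → Vec n) (α : Fin l → ℝ) (u : Vec n) (i j : StateIdx n) :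
    |stateMatrix z α u i j| ≤ ‖u‖ + ‖weightedSource z α‖ + 1 := by
  have h1 := norm_nonneg u
  have h2 := norm_nonneg (weightedSource z α)
  have h3 : ∀ j, |u j| ≤ ‖u‖ := fun j => PiLp.norm_apply_le u j
  have h4 : ∀ j, |weightedSource z α j| ≤ ‖weightedSource z α‖ := fun j =>
    PiLp.norm_apply_le (weightedSource z α) j
  have h5 : ∀ c : ℝ, |c| ≤ 1 → |c| ≤ ‖u‖ + ‖weightedSource z α‖ + 1 := fun c hc => by linarith
  rcases i with i | i | i <;> rcases j with j | j | j
  · simp [stateMatrix]; positivity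
  · simp only [stateMatrix, fromBlocks_apply₁₂, fromCols_apply_inl, Matrix.one_apply]
    apply h5; split_ifs <;> simp
  · simp [stateMatrix]; positivity
  · simp [stateMatrix]; positivity
  · simp [stateMatrix]; positivity
  · simp [stateMatrix]; positivity
  · fin_cases i <;> simp [stateMatrix] <;> first | positivity | linarith [h3 j]
  · fin_cases i <;> simp [stateMatrix] <;> first | positivity | linarith [h3 j, h4 j]
  · fin_cases i <;> fin_cases j <;> simp [stateMatrix] <;> positivity

theorem continuousOn_stateMatrix (z : Fin l → Vec n) (α : Fin l → ℝ) {u : ℝ → Vec n}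
    {s : Set ℝ} (hu : ContinuousOn u s) : ContinuousOn (fun t => stateMatrix z α (u t)) s := by
  have hcomp : ∀ j, ContinuousOn (fun t => u t j) s := fun j =>
    (EuclideanSpace.proj (𝕜 := ℝ) j).continuous.comp_continuousOn hu
  refine continuousOn_pi.2 fun i => continuousOn_pi.2 fun j => ?_
  rcases i with i | i | i <;> rcases j with j | j | j
  · simpa [stateMatrix] using continuousOn_const
  · simpa [stateMatrix] using continuousOn_const
  · simpa [stateMatrix] using continuousOn_const
  · simpa [stateMatrix] using continuousOn_const
  · simpa [stateMatrix] using continuousOn_const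
  · simpa [stateMatrix] using continuousOn_const
  · fin_cases i
    · simpa [stateMatrix] using hcomp j
    · simpa [stateMatrix] using continuousOn_const
    · simpa [stateMatrix] using continuousOn_const
  · fin_cases i
    · simpa [stateMatrix] using continuousOn_const
    · simpa [stateMatrix] using hcomp j
    · simpa [stateMatrix] using continuousOn_const
  · simpa [stateMatrix] using continuousOn_const

/-- The continuous linear map `x ↦ D(α) Zᵀ x`. -/
noncomputable def sourceMap (z : Fin l → Vec n) (α : Fin l → ℝ) : Vec n →L[ℝ] (Fin l → ℝ) :=
  (Matrix.mulVecLin (weightMatrix α * (sourceMatrix z)ᵀ)).toContinuousLinearMap.comp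
    (EuclideanSpace.equiv (Fin n) ℝ).toContinuousLinearMap

theorem sourceMap_apply (z : Fin l → Vec n) (α : Fin l → ℝ) (x : Vec n) :
    sourceMap z α x = (weightMatrix α * (sourceMatrix z)ᵀ) *ᵥ fun j => x j := rfl

theorem dotProduct_excitationMatrix (z : Fin l → Vec n) (α : Fin l → ℝ) {v : ℝ → Vec n}
    {δ t : ℝ} (hv : ContinuousOn v (uIcc t (t + δ))) (ξ : Vec n) :
    (fun j => ξ j) ⬝ᵥ (excitationMatrix z α v δ t *ᵥ fun j => ξ j)
      = sourceMap z α ξ ⬝ᵥ sourceMap z α ξ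
        + 1 / δ * ∫ s in t..(t + δ), inner ℝ (v s) ξ ^ 2 := by
  have hcomp : ∀ j, ContinuousOn (fun s => v s j) (uIcc t (t + δ)) := fun j =>
    (EuclideanSpace.proj (𝕜 := ℝ) j).continuous.comp_continuousOn hv
  have h1 : ∀ s, inner ℝ (v s) ξ ^ 2 = ∑ i, ∑ j, ξ i * (v s i * v s j * ξ j) := fun s => by
    rw [PiLp.inner_apply, pow_two, Finset.sum_mul_sum]
    refine Finset.sum_congr rfl fun i _ => Finset.sum_congr rfl fun j _ => ?_
    simp only [RCLike.inner_apply, conj_trivial]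
    ring
  have hint : ∀ i j, IntervalIntegrable (fun s => v s i * v s j) MeasureTheory.volume t (t + δ) :=
    fun i j => ((hcomp i).mul (hcomp j)).intervalIntegrable
  have h2 : ∫ s in t..(t + δ), inner ℝ (v s) ξ ^ 2
      = ∑ i, ξ i * ∑ j, (∫ s in t..(t + δ), v s i * v s j) * ξ j := by
    simp_rw [h1]
    rw [intervalIntegral.integral_finsetSum fun i _ => ?_]
    · refine Finset.sum_congr rfl fun i _ => ?_
      rw [intervalIntegral.integral_finsetSum fun j _ => ?_, Finset.mul_sum]
      · refine Finset.sum_congr rfl fun j _ => ?_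
        rw [intervalIntegral.integral_const_mul, intervalIntegral.integral_mul_const]
      · exact ((hint i j).mul_const _).const_mul _
    · exact ContinuousOn.intervalIntegrable (continuousOn_finsetSum _ fun j _ =>
        continuousOn_const.mul (((hcomp i).mul (hcomp j)).mul continuousOn_const))
  have h3 : (sourceMatrix z * (weightMatrix α)ᵀ * weightMatrix α * (sourceMatrix z)ᵀ)
      = (weightMatrix α * (sourceMatrix z)ᵀ)ᵀ * (weightMatrix α * (sourceMatrix z)ᵀ) := by
    simp only [transpose_mul, transpose_transpose, Matrix.mul_assoc]
  rw [excitationMatrix, h3, add_mulVec, dotProduct_add, ← mulVec_mulVec, mulVec_transpose,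
    dotProduct_comm, ← dotProduct_mulVec, smul_mulVec, dotProduct_smul, smul_eq_mul, h2]
  rfl

/-- All coordinates of the free solution are independent here: nothing ties the last two to `⟪a, x⟫`
and `‖a‖ ^ 2`, as befits an error that does not satisfy these relations. -/
theorem uniformlyObservable_augmented (z : Fin l → Vec n) (α : Fin l → ℝ)
    {u u' u'' : ℝ → Vec n}
    (hu' : ∀ t, 0 ≤ t → HasDerivWithinAt u (u' t) (Ici 0) t)
    (hu'' : ∀ t, 0 ≤ t → HasDerivWithinAt u' (u'' t) (Ici 0) t)
    (hub : ∃ B, ∀ t, 0 ≤ t → ‖u t‖ ≤ B) (hub' : ∃ B, ∀ t, 0 ≤ t → ‖u' t‖ ≤ B)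
    (hub'' : ∃ B, ∀ t, 0 ≤ t → ‖u'' t‖ ≤ B) {δ μ : ℝ} (hδ : 0 < δ) (hμ : 0 < μ)
    (hpe : ∀ t, 0 ≤ t → (excitationMatrix z α u' δ t
      - μ • (1 : Matrix (Fin n) (Fin n) ℝ)).PosSemidef) :
    UniformlyObservable (fun t => stateMatrix z α (u t)) (outputMatrix z α) := by
  obtain ⟨B₀, hB₀⟩ := hub
  obtain ⟨B₁, hB₁⟩ := hub'
  obtain ⟨B₂, hB₂⟩ := hub''
  set B := max (max B₀ B₁) (max B₂ 1) with hB
  have hBpos : 0 < B := lt_max_of_lt_right (lt_max_of_lt_right one_pos)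
  have hsq : ∀ ξ : Vec n, (fun j => ξ j) ⬝ᵥ (fun j => ξ j) = ‖ξ‖ ^ 2 := fun ξ => by
    rw [EuclideanSpace.norm_sq_eq]
    exact Finset.sum_congr rfl fun j _ => by rw [Real.norm_eq_abs, sq_abs, pow_two]
  obtain ⟨Λ, hΛ, K, hK, hwin⟩ := exists_window_bound (sourceMap z α) (weightedSource z α)
    hδ (Real.sqrt_pos.2 hμ) hBpos hu' hu''
    (fun s hs => (hB₀ s hs).trans ((le_max_left _ _).trans (le_max_left _ _)))
    (fun s hs => (hB₁ s hs).trans ((le_max_right _ _).trans (le_max_left _ _)))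
    (fun s hs => (hB₂ s hs).trans ((le_max_left _ _).trans (le_max_right _ _)))
    (fun t ht ξ => by
      rw [Real.sq_sqrt hμ.le, ← dotProduct_excitationMatrix z α (fun s hs => ?_) ξ, ← hsq]
      · exact mul_dotProduct_self_le_of_posSemidef (hpe t ht) _
      · rw [uIcc_of_le (by linarith)] at hs
        exact ((hu'' s (ht.trans hs.1)).continuousWithinAt).mono fun r hr => by
          rw [uIcc_of_le (by linarith)] at hr
          exact ht.trans hr.1)
  refine ⟨Λ, hΛ, K, hK, fun t ht X hX J J' hJ hJ' => ?_⟩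
  have hXd : ∀ i s, 0 ≤ s → HasDerivWithinAt (fun s => X s i)
      ((stateMatrix z α (u s) *ᵥ X s) i) (Ici 0) s := fun i s hs =>
    hasDerivWithinAt_pi.1 (hX s hs) i
  simp only [stateMatrix_mulVec] at hXd
  set x : Vec n := WithLp.toLp 2 fun j => X t (Sum.inl j) with hx
  set a : Vec n := WithLp.toLp 2 fun j => X t (Sum.inr (Sum.inl j)) with ha
  set b := X t (Sum.inr (Sum.inr 2)) with hb
  have hconst_a : ∀ s, t ≤ s → ∀ j, X s (Sum.inr (Sum.inl j)) = a j := fun s hs j =>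
    (eq_of_hasDerivWithinAt_zero ht hs fun r hr => by
      simpa using hXd (Sum.inr (Sum.inl j)) r (ht.trans hr.1)).symm
  have hconst_b : ∀ s, t ≤ s → X s (Sum.inr (Sum.inr 2)) = b := fun s hs =>
    (eq_of_hasDerivWithinAt_zero ht hs fun r hr => by
      simpa using hXd (Sum.inr (Sum.inr 2)) r (ht.trans hr.1)).symm
  have hline : ∀ s, t ≤ s → ∀ j, X s (Sum.inl j) = (x + (s - t) • a) j := fun s hs j => by
    have := eq_of_hasDerivWithinAt_zero (f := fun s => X s (Sum.inl j) - (s - t) * a j) ht hs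
      fun r hr => by
        refine ((hXd (Sum.inl j) r (ht.trans hr.1)).fun_sub
          (((hasDerivWithinAt_id r (Ici 0)).sub_const t).mul_const (a j))).congr_deriv ?_
        simp [hconst_a r hr.1]
    simp only [sub_self, zero_mul, sub_zero] at this
    rw [PiLp.add_apply, PiLp.smul_apply, smul_eq_mul, hx]
    simp only
    linarith
  have ha' : ∀ s, t ≤ s → (WithLp.toLp 2 fun j => X s (Sum.inr (Sum.inl j)) : Vec n) = a :=
    fun s hs => by ext j; exact hconst_a s hs j
  have hx' : ∀ s, t ≤ s → (WithLp.toLp 2 fun j => X s (Sum.inl j) : Vec n) = x + (s - t) • a :=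
    fun s hs => by ext j; exact hline s hs j
  have htraj : IsWindowTrajectory (sourceMap z α) (weightedSource z α) u t Λ x a b
      (fun s => X s (Sum.inr (Sum.inr 0))) (fun s => X s (Sum.inr (Sum.inr 1))) J J' := by
    refine ⟨fun s hs hts => ?_, fun s hs hts => ?_, fun s hs _ => hJ s hs, fun s hs => ?_⟩
    · have := hXd (Sum.inr (Sum.inr 0)) s hs
      rw [ha' s hts, hx' s hts] at this
      simpa using this
    · have := hXd (Sum.inr (Sum.inr 1)) s hs
      rw [ha' s hts, hconst_b s hts] at this
      simpa using this
    · refine le_of_eq_of_le ?_ (hJ' s hs)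
      rw [outputMatrix_mulVec, sourceMap_apply]
      simp only [← hline s hs.1]
      simp only [dotProduct, Fintype.sum_sum_type, Sum.elim_inl, Sum.elim_inr,
        Finset.univ_unique, Finset.sum_const, Finset.card_singleton, one_smul, pow_two]
  refine le_of_eq_of_le ?_ (hwin t ht x a b _ _ J J' htraj)
  rw [← hsq, ← hsq]
  simp only [dotProduct, Fintype.sum_sum_type, Fin.sum_univ_three, pow_two, hx, ha, hb]
  ring

theorem euclNorm_eq_sqrt {ι : Type*} [Fintype ι] (v : ι → ℝ) :
    euclNorm v = Real.sqrt (v ⬝ᵥ v) := by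
  rw [euclNorm, EuclideanSpace.norm_eq]
  congr 1
  exact Finset.sum_congr rfl fun j _ => by rw [Real.norm_eq_abs, sq_abs, pow_two]

theorem weightedOutput_eq (z : Fin l → Vec n) {α : Fin l → ℝ} (hα : ∑ i, α i = 1) (x : Vec n) :
    weightedOutput z α x = ‖x‖ ^ 2 / 2 - inner ℝ x (weightedSource z α) := by
  have h : ∀ i, α i * (rangeMeas z x i - ‖z i‖ ^ 2 / 2)
      = α i * (‖x‖ ^ 2 / 2) - α i * inner ℝ x (z i) := fun i => by
    rw [rangeMeas, norm_sub_sq_real]; ring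
  rw [weightedOutput, Finset.sum_congr rfl fun i _ => h i, Finset.sum_sub_distrib,
    ← Finset.sum_mul, hα, one_mul, weightedSource, inner_sum]
  simp only [inner_smul_right]

/-- Every squared range and `y₀` contain the same term `‖x‖ ^ 2 / 2`, the latter because the weights
sum to one; subtraction leaves a linear function of `x`. -/
theorem output_eq (z : Fin l → Vec n) {α : Fin l → ℝ} (hα : ∑ i, α i = 1) (a x : Vec n) :
    output z α x = outputMatrix z α *ᵥ augState z α a x := by
  rw [outputMatrix_mulVec]
  funext i
  rcases i with i | i
  · simp [output, augState]
  · have h1 : ∀ i, ((sourceMatrix z)ᵀ *ᵥ fun j => x j) i = inner ℝ x (z i) := fun i => by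
      simp [sourceMatrix, mulVec, dotProduct, PiLp.inner_apply]
    simp only [output, augState, Sum.elim_inr, Sum.elim_inl]
    rw [weightedOutput_eq z hα, rangeMeas, norm_sub_sq_real, ← mulVec_mulVec, weightMatrix,
      sub_mulVec, one_mulVec, Pi.sub_apply, h1, vecMulVec_mulVec]
    simp only [Pi.smul_apply, Pi.one_apply, dotProduct, h1, weightedSource, inner_sum,
      inner_smul_right, MulOpposite.smul_eq_mul_unop, MulOpposite.unop_op]
    ring

/-- The derivative of `y₀` contains `⟪a, x⟫` and that of `⟪a, x⟫` contains `‖a‖ ^ 2`, a constant, so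
the chain of adjoined coordinates closes. -/
theorem hasDerivWithinAt_augState (z : Fin l → Vec n) {α : Fin l → ℝ} (hα : ∑ i, α i = 1)
    {u : ℝ → Vec n} {a : Vec n} {x : ℝ → Vec n} (hx : IsBodyMotion u a x) {t : ℝ} (ht : 0 ≤ t) :
    HasDerivWithinAt (fun s => augState z α a (x s))
      (stateMatrix z α (u t) *ᵥ augState z α a (x t) + augInput z α (u t)) (Ici 0) t := by
  have hd := hx t ht
  have hconst : ∀ c : ℝ, HasDerivWithinAt (fun _ : ℝ => c) 0 (Ici 0) t := fun c =>
    hasDerivWithinAt_const _ _ _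
  have hcomp : ∀ j, HasDerivWithinAt (fun s => x s j) ((u t + a) j) (Ici 0) t := fun j =>
    (EuclideanSpace.proj (𝕜 := ℝ) j).hasFDerivAt.comp_hasDerivWithinAt t hd
  rw [stateMatrix_mulVec]
  refine hasDerivWithinAt_pi.2 fun i => ?_
  rcases i with i | i | i
  · refine (hcomp i).congr_deriv ?_
    simp [augState, augInput, add_comm]
  · simpa [augState, augInput] using hconst (a i)
  · fin_cases i
    · have h1 : HasDerivWithinAt (fun s => ‖x s‖ ^ 2 / 2 - inner ℝ (x s) (weightedSource z α))
          (2 * inner ℝ (x t) (u t + a) / 2 - inner ℝ (u t + a) (weightedSource z α))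
          (Ici 0) t :=
        (hd.norm_sq.div_const 2).fun_sub
          (by simpa using hd.inner ℝ (hasDerivWithinAt_const t (Ici 0) (weightedSource z α)))
      simp only [augState, augInput, Fin.zero_eta, Fin.isValue, Sum.elim_inr, cons_val_zero,
        weightedOutput_eq z hα, Pi.add_apply, Sum.elim_inl, cons_val_one]
      refine h1.congr_deriv ?_
      change _ = inner ℝ (u t) (x t) - inner ℝ (weightedSource z α) a + inner ℝ a (x t)
        + -inner ℝ (u t) (weightedSource z α)
      rw [inner_add_right, inner_add_left, real_inner_comm (u t) (x t),
        real_inner_comm a (x t), real_inner_comm a (weightedSource z α)]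
      ring
    · have h1 : HasDerivWithinAt (fun s => inner ℝ a (x s)) (inner ℝ a (u t + a)) (Ici 0) t := by
        simpa using (hasDerivWithinAt_const t (Ici 0) a).inner ℝ hd
      refine h1.congr_deriv ?_
      change _ = inner ℝ (u t) a + ‖a‖ ^ 2 + 0
      rw [inner_add_right, real_inner_self_eq_norm_sq, real_inner_comm a (u t), add_zero]
    · refine (hconst (‖a‖ ^ 2)).congr_deriv ?_
      simp [augInput]

end Augmented

/-! ### Coefficient bounds, the error equation and the conclusion. -/

theorem exists_riccatiBounds {ι κ : Type*} [Fintype ι] [Fintype κ] [DecidableEq ι]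
    [DecidableEq κ] {A : ℝ → Matrix ι ι ℝ} (C : Matrix κ ι ℝ) {Q : ℝ → Matrix κ κ ℝ}
    {V : ℝ → Matrix ι ι ℝ} (hA : ∃ B, ∀ t, 0 ≤ t → ∀ i j, |A t i j| ≤ B)
    (hQb : ∃ B, ∀ t, 0 ≤ t → ∀ i j, |Q t i j| ≤ B)
    (hQ : ∃ ε : ℝ, 0 < ε ∧ ∀ t, 0 ≤ t → (Q t - ε • (1 : Matrix κ κ ℝ)).PosSemidef)
    (hVb : ∃ B, ∀ t, 0 ≤ t → ∀ i j, |V t i j| ≤ B)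
    (hV : ∃ ε : ℝ, 0 < ε ∧ ∀ t, 0 ≤ t → (V t - ε • (1 : Matrix ι ι ℝ)).PosSemidef) :
    ∃ ε K, RiccatiBounds A C (fun t => Cᵀ * Q t * C) V ε K := by
  obtain ⟨BA, hBA⟩ := hA
  obtain ⟨εQ, hεQ, hQ⟩ := hQ
  obtain ⟨εV, hεV, hV⟩ := hV
  obtain ⟨K₁, hK₁, h1⟩ := exists_dotProduct_self_mulVec_le ι ι BA
  obtain ⟨K₂, hK₂, h2⟩ := exists_dotProduct_self_mulVec_le_of_bounded (s := Ici 0) hQb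
  obtain ⟨K₃, hK₃, h3⟩ := exists_dotProduct_self_mulVec_le_of_bounded (s := Ici 0) hVb
  obtain ⟨K₄, hK₄, h4⟩ := exists_dotProduct_self_mulVec_le_of_bounded (s := {(0 : ℝ)})
    (exists_bound_of_continuousOn_matrix (M := fun _ => C) isCompact_singleton continuousOn_const)
  obtain ⟨K₅, hK₅, h5⟩ := exists_dotProduct_self_mulVec_le_of_bounded (s := {(0 : ℝ)})
    (exists_bound_of_continuousOn_matrix (M := fun _ => Cᵀ) isCompact_singleton continuousOn_const)
  have weaken : ∀ {c d e : ℝ} (v : ι → ℝ), c ≤ d * (v ⬝ᵥ v) → d ≤ e →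
      c ≤ e * (v ⬝ᵥ v) := fun v hc hd =>
    hc.trans (mul_le_mul_of_nonneg_right hd (dotProduct_self_nonneg v))
  have hK52 : 0 < K₅ * K₂ := by positivity
  refine ⟨min εQ εV, K₁ + K₃ + K₄ + K₅ * K₂, lt_min hεQ hεV, by positivity,
    fun t ht v => weaken v (h1 _ (hBA t ht) v) (by linarith),
    fun t ht v => weaken v (h1 _ (fun i j => hBA t ht j i) v) (by linarith),
    fun v => weaken v (h4 0 rfl v) (by linarith), fun t ht => ?_, fun t ht v => ?_,
    fun t ht v => ?_, fun t ht => transpose_eq_of_sub_smul_one_posSemidef (hV t ht),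
    fun t ht v => ?_, fun t ht v => weaken v (h3 t ht v) (by linarith)⟩
  · simp [transpose_mul, transpose_eq_of_sub_smul_one_posSemidef (hQ t ht), Matrix.mul_assoc]
  · refine (mul_le_mul_of_nonneg_right (min_le_left _ _) (dotProduct_self_nonneg _)).trans ?_
    rw [← mulVec_mulVec, ← mulVec_mulVec, dotProduct_mulVec v, vecMul_transpose]
    exact mul_dotProduct_self_le_of_posSemidef (hQ t ht) _
  · simp only [← mulVec_mulVec]
    refine ((h5 0 rfl _).trans ?_).trans (mul_le_mul_of_nonneg_right
      (by linarith : K₅ * K₂ ≤ K₁ + K₃ + K₄ + K₅ * K₂) (dotProduct_self_nonneg _))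
    rw [mul_assoc]
    exact mul_le_mul_of_nonneg_left (h2 t ht _) hK₅.le
  · refine (mul_le_mul_of_nonneg_right (min_le_right _ _) (dotProduct_self_nonneg _)).trans ?_
    exact mul_dotProduct_self_le_of_posSemidef (hV t ht) _

section Observer

variable {ι κ : Type*} [Fintype ι] [Fintype κ] {A : ℝ → Matrix ι ι ℝ} {b : ℝ → ι → ℝ}
  {G : ℝ → Matrix ι κ ℝ} {C : Matrix κ ι ℝ} {y : ℝ → κ → ℝ}

theorem exists_isObserverTrajectory (hA : ContinuousOn A (Ici 0)) (hb : ContinuousOn b (Ici 0))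
    (hG : ContinuousOn G (Ici 0)) (hy : ContinuousOn y (Ici 0)) (X₀ : ι → ℝ) :
    ∃ X, X 0 = X₀ ∧ IsObserverTrajectory A b G C y X := by
  have hM : ContinuousOn (fun t => A t - G t * C) (Ici 0) := by
    rw [continuousOn_iff_continuous_domRestrict] at *
    exact hA.sub (hG.matrix_mul continuous_const)
  have hc : ContinuousOn (fun t => b t + G t *ᵥ y t) (Ici 0) := by
    rw [continuousOn_iff_continuous_domRestrict] at *
    exact hb.add (hG.matrix_mulVec hy)
  obtain ⟨X, hX0, hX⟩ := exists_linear_solution hM hc 0 X₀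
  refine ⟨X, hX0, fun t ht => (hX t ht).congr_deriv ?_⟩
  rw [sub_mulVec, mulVec_sub, ← mulVec_mulVec]
  abel

theorem IsObserverTrajectory.hasDerivWithinAt_error {X Xhat : ℝ → ι → ℝ}
    (h : IsObserverTrajectory A b G C y Xhat)
    (hX : ∀ t, 0 ≤ t → HasDerivWithinAt X (A t *ᵥ X t + b t) (Ici 0) t)
    (hy : ∀ t, y t = C *ᵥ X t) {t : ℝ} (ht : 0 ≤ t) :
    HasDerivWithinAt (fun s => X s - Xhat s)
      (A t *ᵥ (X t - Xhat t) - G t *ᵥ (C *ᵥ (X t - Xhat t))) (Ici 0) t := by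
  refine ((hX t ht).fun_sub (h t ht)).congr_deriv ?_
  rw [hy, ← mulVec_sub, mulVec_sub (A t)]
  abel

end Observer

theorem globallyExpStabilizes_of_exp_bound {n l : ℕ} {z : Fin l → Vec n} {α : Fin l → ℝ}
    (hα : ∑ i, α i = 1) {u : ℝ → Vec n} (hu : ContinuousOn u (Ici 0))
    {G : ℝ → Matrix (StateIdx n) (OutIdx l) ℝ} (hG : ContinuousOn G (Ici 0))
    (hexp : ∃ c > 0, ∃ r > 0, ∀ e : ℝ → StateIdx n → ℝ,
      (∀ t, 0 ≤ t → HasDerivWithinAt e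
        (stateMatrix z α (u t) *ᵥ e t - G t *ᵥ (outputMatrix z α *ᵥ e t)) (Ici 0) t) →
      ∀ t₀ t, 0 ≤ t₀ → t₀ ≤ t →
        e t ⬝ᵥ e t ≤ c * Real.exp (-r * (t - t₀)) * (e t₀ ⬝ᵥ e t₀)) :
    GloballyExpStabilizes z α u G := by
  refine ⟨fun a x hx X₀ => ?_, ?_⟩
  · refine exists_isObserverTrajectory (continuousOn_stateMatrix z α hu) ?_ hG ?_ X₀
    · refine continuousOn_pi.2 fun i => ?_
      rcases i with i | i | i
      · exact (EuclideanSpace.proj (𝕜 := ℝ) i).continuous.comp_continuousOn hu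
      · exact continuousOn_const
      · fin_cases i
        · exact (hu.inner continuousOn_const).neg
        · exact continuousOn_const
        · exact continuousOn_const
    · simp only [output_eq z hα a]
      exact fun t ht => (hasDerivWithinAt_const_mulVec _
        (hasDerivWithinAt_augState z hα hx ht)).continuousWithinAt
  · obtain ⟨c, hc, r, hr, hexp⟩ := hexp
    refine ⟨Real.sqrt c, Real.sqrt_pos.2 hc, r / 2, by positivity,
      fun a x hx Xhat hXhat t₀ t ht₀ htt => ?_⟩
    have h := hexp (fun s => augState z α a (x s) - Xhat s) (fun s hs =>
      hXhat.hasDerivWithinAt_error (fun _ => hasDerivWithinAt_augState z hα hx)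
        (fun _ => output_eq z hα a _) hs) t₀ t ht₀ htt
    rw [euclNorm_eq_sqrt, euclNorm_eq_sqrt]
    refine (Real.sqrt_le_sqrt h).trans (le_of_eq ?_)
    rw [Real.sqrt_mul (by positivity), Real.sqrt_mul hc.le, ← Real.exp_half]
    congr 3
    ring

/-- The Riccati equation of the observer is solvable on the half-line and the observer is globally
exponentially stable, for weights `Q` and `V` bounded below by an arbitrary positive real multiple
of the identity. -/
theorem riccati_observer_globallyExpStabilizes {n l : ℕ}
    (z : Fin l → Vec n) (α : Fin l → ℝ) (hα : ∑ i, α i = 1)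
    (u u' u'' : ℝ → Vec n)
    (hu' : ∀ t, 0 ≤ t → HasDerivWithinAt u (u' t) (Set.Ici 0) t)
    (hu'' : ∀ t, 0 ≤ t → HasDerivWithinAt u' (u'' t) (Set.Ici 0) t)
    (hub : ∃ B, ∀ t, 0 ≤ t → ‖u t‖ ≤ B)
    (hub' : ∃ B, ∀ t, 0 ≤ t → ‖u' t‖ ≤ B)
    (hub'' : ∃ B, ∀ t, 0 ≤ t → ‖u'' t‖ ≤ B)
    (δ μ : ℝ) (hδ : 0 < δ) (hμ : 0 < μ)
    (hpe : ∀ t, 0 ≤ t →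
      (excitationMatrix z α u' δ t
        - μ • (1 : Matrix (Fin n) (Fin n) ℝ)).PosSemidef)
    (k : ℝ → ℝ) (hkc : ContinuousOn k (Set.Ici 0)) (hk : ∀ t, 0 ≤ t → 1 / 2 ≤ k t)
    (Q : ℝ → Matrix (OutIdx l) (OutIdx l) ℝ)
    (hQc : ContinuousOn Q (Set.Ici 0))
    (hQb : ∃ B, ∀ t, 0 ≤ t → ∀ i j, |Q t i j| ≤ B)
    (hQ : ∃ ε : ℝ, 0 < ε ∧ ∀ t, 0 ≤ t →
      (Q t - ε • (1 : Matrix (OutIdx l) (OutIdx l) ℝ)).PosSemidef)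
    (V : ℝ → Matrix (StateIdx n) (StateIdx n) ℝ)
    (hVc : ContinuousOn V (Set.Ici 0))
    (hVb : ∃ B, ∀ t, 0 ≤ t → ∀ i j, |V t i j| ≤ B)
    (hV : ∃ ε : ℝ, 0 < ε ∧ ∀ t, 0 ≤ t →
      (V t
        - ε • (1 : Matrix (StateIdx n) (StateIdx n) ℝ)).PosSemidef)
    (P₀ : Matrix (StateIdx n) (StateIdx n) ℝ) (hP₀ : P₀.PosDef) :
    (∃ P, IsRiccatiSolution (fun t => stateMatrix z α (u t))
      (outputMatrix z α) Q V P ∧ P 0 = P₀) ∧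
    (∀ P, IsRiccatiSolution (fun t => stateMatrix z α (u t))
      (outputMatrix z α) Q V P → P 0 = P₀ →
      GloballyExpStabilizes z α u
        (riccatiGain k P (outputMatrix z α) Q)) := by
  have huc : ContinuousOn u (Set.Ici 0) := fun t ht => (hu' t ht).continuousWithinAt
  have hAc := continuousOn_stateMatrix z α huc
  have hPsd : ∀ {ι : Type} [Fintype ι] [DecidableEq ι] {M : Matrix ι ι ℝ} {ε : ℝ}, 0 < ε →
      (M - ε • (1 : Matrix ι ι ℝ)).PosSemidef → ∀ v, 0 ≤ v ⬝ᵥ M.mulVec v := fun hε hM v =>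
    (mul_nonneg hε.le (dotProduct_self_nonneg v)).trans
      (mul_dotProduct_self_le_of_posSemidef hM v)
  refine ⟨?_, fun P hP hP0 => ?_⟩
  · obtain ⟨εQ, hεQ, hQ⟩ := hQ
    obtain ⟨εV, hεV, hV⟩ := hV
    exact exists_isRiccatiSolution hAc hQc hVc
      (fun t ht => hPsd hεQ (hQ t ht)) (fun t ht => hPsd hεV (hV t ht)) hP₀
  · have hobs := uniformlyObservable_augmented z α hu' hu'' hub hub' hub'' hδ hμ hpe
    have hAb : ∃ B, ∀ t, 0 ≤ t → ∀ i j, |stateMatrix z α (u t) i j| ≤ B := by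
      obtain ⟨B, hB⟩ := hub
      exact ⟨B + ‖weightedSource z α‖ + 1, fun t ht i j =>
        (abs_stateMatrix_le z α (u t) i j).trans (by linarith [hB t ht])⟩
    obtain ⟨ε, K, hb⟩ := exists_riccatiBounds (outputMatrix z α)
      hAb hQb hQ hVb hV
    have hQs : ∀ t, 0 ≤ t → (Q t).transpose = Q t := by
      obtain ⟨εQ, -, hQ⟩ := hQ
      exact fun t ht => transpose_eq_of_sub_smul_one_posSemidef (hQ t ht)
    have hG : ContinuousOn (riccatiGain k P (outputMatrix z α) Q)
        (Set.Ici 0) := by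
      have hPc := hP.continuousOn
      rw [continuousOn_iff_continuous_domRestrict] at *
      exact hkc.smul ((hPc.matrix_mul continuous_const).matrix_mul hQc)
    refine globallyExpStabilizes_of_exp_bound hα huc hG ?_
    obtain ⟨c, hc, r, hr, hexp⟩ := hP.exists_exp_bound hAc hQc hQs hb hobs (hP0 ▸ hP₀) hkc hk
    refine ⟨c, hc, r, hr, fun e he => hexp e fun t ht => (he t ht).congr_deriv ?_⟩
    simp only [riccatiGain, Matrix.mulVec_mulVec, Matrix.smul_mul, Matrix.smul_mulVec,
      Matrix.mul_assoc]

end RangeObserver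

theorem mainTheorem5 {n l : ℕ} (hn : 2 ≤ n)
    -- source points and weights
    (z : Fin l → RangeObserver.Vec n) (α : Fin l → ℝ) (hα : ∑ i, α i = 1)
    -- measured velocity: bounded, twice differentiable with bounded derivatives
    (u u' u'' : ℝ → RangeObserver.Vec n)
    (hu' : ∀ t, 0 ≤ t → HasDerivWithinAt u (u' t) (Set.Ici 0) t)
    (hu'' : ∀ t, 0 ≤ t → HasDerivWithinAt u' (u'' t) (Set.Ici 0) t)
    (hub : ∃ B, ∀ t, 0 ≤ t → ‖u t‖ ≤ B)
    (hub' : ∃ B, ∀ t, 0 ≤ t → ‖u' t‖ ≤ B)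
    (hub'' : ∃ B, ∀ t, 0 ≤ t → ‖u'' t‖ ≤ B)
    -- persistent excitation
    (δ μ : ℝ) (hδ : 0 < δ) (hμ : 0 < μ)
    (hpe : ∀ t, 0 ≤ t →
      (RangeObserver.excitationMatrix z α u' δ t
        - μ • (1 : Matrix (Fin n) (Fin n) ℝ)).PosSemidef)
    -- tuning parameters of the observer
    (k : ℝ → ℝ) (hkc : ContinuousOn k (Set.Ici 0)) (hk : ∀ t, 0 ≤ t → 1 / 2 ≤ k t)
    (Q : ℝ → Matrix (RangeObserver.OutIdx l) (RangeObserver.OutIdx l) ℝ)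
    (hQc : ContinuousOn Q (Set.Ici 0))
    (hQb : ∃ B, ∀ t, 0 ≤ t → ∀ i j, |Q t i j| ≤ B)
    (hQ : ∃ ε > 0, ∀ t, 0 ≤ t →
      (Q t - ε • (1 : Matrix (RangeObserver.OutIdx l) (RangeObserver.OutIdx l) ℝ)).PosSemidef)
    (V : ℝ → Matrix (RangeObserver.StateIdx n) (RangeObserver.StateIdx n) ℝ)
    (hVc : ContinuousOn V (Set.Ici 0))
    (hVb : ∃ B, ∀ t, 0 ≤ t → ∀ i j, |V t i j| ≤ B)
    (hV : ∃ ε > 0, ∀ t, 0 ≤ t →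
      (V t
        - ε • (1 : Matrix (RangeObserver.StateIdx n) (RangeObserver.StateIdx n) ℝ)).PosSemidef)
    (P₀ : Matrix (RangeObserver.StateIdx n) (RangeObserver.StateIdx n) ℝ) (hP₀ : P₀.PosDef) :
    -- the Riccati equation has a solution on the half-line
    (∃ P, RangeObserver.IsRiccatiSolution (fun t => RangeObserver.stateMatrix z α (u t))
      (RangeObserver.outputMatrix z α) Q V P ∧ P 0 = P₀) ∧
    -- and the observer built from it globally exponentially stabilizes the error at zero
    (∀ P, RangeObserver.IsRiccatiSolution (fun t => RangeObserver.stateMatrix z α (u t))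
      (RangeObserver.outputMatrix z α) Q V P → P 0 = P₀ →
      RangeObserver.GloballyExpStabilizes z α u
        (RangeObserver.riccatiGain k P (RangeObserver.outputMatrix z α) Q)) := by
  -- In a binder `∃ ε > 0` without ascription `ε` elaborates as a natural number, acting through
  -- `nsmul`; its cast serves as the real lower bound.
  have real_bound : ∀ {ι : Type} [DecidableEq ι] {M : ℝ → Matrix ι ι ℝ},
      (∃ ε > 0, ∀ t, 0 ≤ t → (M t - ε • (1 : Matrix ι ι ℝ)).PosSemidef) →
      ∃ ε : ℝ, 0 < ε ∧ ∀ t, 0 ≤ t → (M t - ε • (1 : Matrix ι ι ℝ)).PosSemidef := by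
    rintro ι _ M ⟨ε, hε, h⟩
    refine ⟨ε, Nat.cast_pos.2 hε, fun t ht => ?_⟩
    rw [Nat.cast_smul_eq_nsmul]
    exact h t ht
  exact RangeObserver.riccati_observer_globallyExpStabilizes z α hα u u' u'' hu' hu'' hub hub'
    hub'' δ μ hδ hμ hpe k hkc hk Q hQc hQb (real_bound hQ) V hVc hVb (real_bound hV) P₀ hP₀
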